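/- Let $t\in\mathbb C$, fix a square root $\sqrt{-t}$, let $\alpha_1,\dots,\alpha_M,\gamma_1,\dots,\gamma_M\in\mathbb C$, and let $z_1,\dots,z_N\in\mathbb C^\times$ with fixed square roots $z_j^{1/2}$ (so $z_j^{-1/2}=(z_j^{1/2})^{-1}$, and half-integral powers of $z_j$ are the corresponding integral powers of $z_j^{1/2}$). **The lattice model.** Let $W=V=\mathbb C^2$ with basis $|0\rangle,|1\rangle$. In the ordered basis $|0\rangle|0\rangle,|0\rangle|1\rangle,|1\rangle|0\rangle,|1\rangle|1\rangle$ of $W\otimes V$ (matrix rows labelled by bras, columns by kets) put $$L(z,\alpha,\gamma)=\begin{pmatrix}1-\gamma z&0&0&0\\0&t+\gamma z&1&0\\0&(t+1)z&\alpha+(1-\alpha\gamma)z&0\\0&0&0&-t\alpha+(1-\alpha\gamma)z\end{pmatrix},$$ $$\widetilde L(z,\alpha,\gamma)=\begin{pmatrix}\alpha+(1-\alpha\gamma)z&0&0&0\\0&t(1-\alpha\gamma)z-\alpha&1&0\\0&(t+1)z&1-\gamma z&0\\0&0&0&t\gamma z+1\end{pmatrix}.$$ On $W_a\otimes V_1\otimes\cdots\otimes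 V_M$ let $L_{aj}$, $\widetilde L_{aj}$ act on $W_a\otimes V_j$ with the parameters $\alpha_j,\gamma_j$, and set $T(z)=L_{aM}(z^{-1})\cdots L_{a1}(z^{-1})$, $\widetilde T(z)=\widetilde L_{a1}(z)\cdots\widetilde L_{aM}(z)$, $$A={}_a\langle0|T|0\rangle_a,\quad B={}_a\langle0|T|1\rangle_a,\quad \widetilde A={}_a\langle1|\widetilde T|1\rangle_a,\quad \widetilde B={}_a\langle0|\widetilde T|1\rangle_a.$$ With the Brubaker–Bump–Chinta–Gunnells (BBCG) $K$-matrix $\mathrm{diag}(-\sqrt{-t}\,z^{1/2},\,z^{-1/2})$ the type II double row operator is $$\mathcal B(z)=-\sqrt{-t}\,z^{1/2}\,\widetilde B(z)A(z)+z^{-1/2}\,\widetilde A(z)B(z).$$ For $1\le x_1<\cdots<x_N\le M$ let $\langle x_1\cdots x_N|$ be the basis covector with $1$ exactly at the sites $x_j$ and $0$ elsewhere, and $|\overline{x_1}\cdots\overline{x_N}\rangle$ the basis vector with $0$ exactly at the sites $x_j$ and $1$ elsewhere. The type II wavefunction and dual wavefunction are $$\Phi(x)=\langle x_1\cdots x_N|\mathcal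 B(z_1)\cdots\mathcal B(z_N)|0^M\rangle,\qquad \overline\Phi(x)=\langle1^M|\mathcal B(z_1)\cdots\mathcal B(z_N)|\overline{x_1}\cdots\overline{x_N}\rangle .$$ **The generalized Bump–Friedberg–Hoffstein Whittaker functions.** For a partition $\lambda=(\lambda_1\ge\dots\ge\lambda_N\ge0)$ put $\mu_j=\lambda_j+N-j$, $D(z)=\det_{1\le j,k\le N}\big(z_k^{N-j+1}-z_k^{-N+j-1}\big)$ and $$o^\pm_\lambda(z_1,\dots,z_N|\alpha|\gamma|t)=\frac{\det_{1\le j,k\le N}\big(h^\pm_{\mu_j}(z_k)-h^\pm_{\mu_j}(z_k^{-1})\big)}{D(z)},$$ $$h^\pm_\mu(z)=(z\pm\sqrt{-t})\prod_{j=1}^{\mu}\big(\alpha_j+(1-\alpha_j\gamma_j)z\big)\prod_{j=\mu+2}^{M}(1-\gamma_jz)\prod_{j=1}^{M}(1-\gamma_jz^{-1}).$$ **Theorem.** Let $1\le x_1<\cdots<x_N\le M$, let $\lambda_j=x_{N-j+1}-N+j-1$ for $j=1,\dots,N$, and let $$P=\prod_{j=1}^N z_j^{j-1/2-N}\big(1-\sqrt{-t}\,z_j\big)\prod_{1\le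 j<k\le N}(1+tz_jz_k)(1+tz_jz_k^{-1}).$$ 1. If $D(z_1,\dots,z_N)\ne0$, then $\Phi(x)=P\;o^+_\lambda(z_1,\dots,z_N|\alpha|\gamma|t)$. 2. If $t\ne0$ and $D(tz_1,\dots,tz_N)\ne0$, then $\overline\Phi(x)=t^{N(M-N)}\,P\;o^-_\lambda(tz_1,\dots,tz_N|-\alpha|-\gamma|t)$. 3. In particular, for $\alpha_j=\gamma_j=0$ ($j=1,\dots,M$) and $D(z_1,\dots,z_N)\ne0$, the wavefunction is $P$ times the Bump–Friedberg–Hoffstein Whittaker function (the statement conjectured by BBCG): $$\Phi(x)=P\;\frac{\det_{1\le j,k\le N}\big(z_k^{\mu_j}(z_k+\sqrt{-t})-z_k^{-\mu_j}(z_k^{-1}+\sqrt{-t})\big)}{D(z_1,\dots,z_N)} .$$ -/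

import Mathlib

namespace ReflectingIce

/-- Configurations of `M` sites. `Config M` labels the standard basis of
`V₁ ⊗ ⋯ ⊗ V_M`, `V_j = ℂ²`; the value `0` is an empty site, `1` an occupied site. -/
abbrev Config (M : ℕ) := Fin M → Fin 2

/-- Operators on `V₁ ⊗ ⋯ ⊗ V_M` in the standard basis: `X s s'` is `⟨s|X|s'⟩`. -/
abbrev QOp (M : ℕ) := Matrix (Config M) (Config M) ℂ

/-- Operators on `W_a ⊗ (V₁ ⊗ ⋯ ⊗ V_M)` in the standard basis. -/
abbrev AuxOp (M : ℕ) := Matrix (Fin 2 × Config M) (Fin 2 × Config M) ℂ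

/-- A `4 × 4` matrix read as an operator on `W ⊗ V` in the ordered basis
`|0⟩|0⟩, |0⟩|1⟩, |1⟩|0⟩, |1⟩|1⟩`. -/
def onPair (A : Matrix (Fin 4) (Fin 4) ℂ) : Matrix (Fin 2 × Fin 2) (Fin 2 × Fin 2) ℂ :=
  A.submatrix (finProdFinEquiv (m := 2) (n := 2)) (finProdFinEquiv (m := 2) (n := 2))

/-- The type `Γ` `L`-operator `L(z, t, α, γ)` on `W ⊗ V`. -/
noncomputable def gammaL (z t α γ : ℂ) : Matrix (Fin 2 × Fin 2) (Fin 2 × Fin 2) ℂ :=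
  onPair !![1 - γ * z, 0, 0, 0;
            0, t + γ * z, 1, 0;
            0, (t + 1) * z, α + (1 - α * γ) * z, 0;
            0, 0, 0, -t * α + (1 - α * γ) * z]

/-- The type `Δ` `L`-operator `L̃(z, t, α, γ)` on `W ⊗ V`. -/
noncomputable def deltaL (z t α γ : ℂ) : Matrix (Fin 2 × Fin 2) (Fin 2 × Fin 2) ℂ :=
  onPair !![α + (1 - α * γ) * z, 0, 0, 0;
            0, t * (1 - α * γ) * z - α, 1, 0;
            0, (t + 1) * z, 1 - γ * z, 0;
            0, 0, 0, t * γ * z + 1]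

/-- The type II `K`-matrix on `W`, with `s = √(-t)` and `w = z^{1/2}`. -/
noncomputable def kMatrixII (s w : ℂ) : Matrix (Fin 2) (Fin 2) ℂ :=
  !![-s * w, 0;
     0, w⁻¹]

/-- The operator on `W_a ⊗ (V₁ ⊗ ⋯ ⊗ V_M)` that acts as `A` on `W_a ⊗ V_j` and as the
identity on the other sites. -/
def atSite {M : ℕ} (j : Fin M) (A : Matrix (Fin 2 × Fin 2) (Fin 2 × Fin 2) ℂ) : AuxOp M :=
  fun p q => if ∀ k, k ≠ j → p.2 k = q.2 k then A (p.1, p.2 j) (q.1, q.2 j) else 0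

/-- The operator `_a⟨a|T|b⟩_a` on the quantum space. -/
def auxEntry {M : ℕ} (a b : Fin 2) (T : AuxOp M) : QOp M :=
  fun s s' => T (a, s) (b, s')

/-- The monodromy matrix `T(z) = L_M(z⁻¹) ⋯ L_1(z⁻¹)`. -/
noncomputable def monodromy {M : ℕ} (z t : ℂ) (α γ : Fin M → ℂ) : AuxOp M :=
  (List.ofFn fun j : Fin M => atSite j (gammaL z⁻¹ t (α j) (γ j))).reverse.prod

/-- The monodromy matrix `T̃(z) = L̃_1(z) ⋯ L̃_M(z)`. -/
noncomputable def monodromyTilde {M : ℕ} (z t : ℂ) (α γ : Fin M → ℂ) : AuxOp M :=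
  (List.ofFn fun j : Fin M => atSite j (deltaL z t (α j) (γ j))).prod

/-- The type II double row operator
`B̃(z) ⟨0|K|0⟩ A(z) + Ã(z) ⟨1|K|1⟩ B(z)`, where `A = ⟨0|T|0⟩`, `B = ⟨0|T|1⟩`,
`Ã = ⟨1|T̃|1⟩`, `B̃ = ⟨0|T̃|1⟩`, `s = √(-t)` and `w = z^{1/2}`. -/
noncomputable def doubleRowB {M : ℕ} (t s z w : ℂ) (α γ : Fin M → ℂ) : QOp M :=
  kMatrixII s w 0 0 •
      (auxEntry 0 1 (monodromyTilde z t α γ) * auxEntry 0 0 (monodromy z t α γ)) +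
    kMatrixII s w 1 1 •
      (auxEntry 1 1 (monodromyTilde z t α γ) * auxEntry 0 1 (monodromy z t α γ))

/-- The product `𝓑(z_1) ⋯ 𝓑(z_N)` of double row operators. -/
noncomputable def doubleRowProd {M N : ℕ} (t s : ℂ) (z w : Fin N → ℂ) (α γ : Fin M → ℂ) :
    QOp M :=
  (List.ofFn fun j : Fin N => doubleRowB t s (z j) (w j) α γ).prod

/-- The configuration of `|x_1 ⋯ x_N⟩`: particles exactly at the sites `x_j`. -/
noncomputable def particles {M N : ℕ} (x : Fin N → Fin M) : Config M :=
  open Classical in fun k => if ∃ j, x j = k then 1 else 0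

/-- The configuration with holes exactly at the sites `x_j`. -/
noncomputable def holes {M N : ℕ} (x : Fin N → Fin M) : Config M :=
  open Classical in fun k => if ∃ j, x j = k then 0 else 1

/-- The type II wavefunction `⟨x_1 ⋯ x_N| 𝓑(z_1) ⋯ 𝓑(z_N) |0^M⟩`. -/
noncomputable def wavefunctionII {M N : ℕ} (t s : ℂ) (z w : Fin N → ℂ) (α γ : Fin M → ℂ)
    (x : Fin N → Fin M) : ℂ :=
  doubleRowProd t s z w α γ (particles x) (fun _ => 0)

/-- The type II dual wavefunction `⟨1^M| 𝓑(z_1) ⋯ 𝓑(z_N) |x̄_1 ⋯ x̄_N⟩`. -/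
noncomputable def dualWavefunctionII {M N : ℕ} (t s : ℂ) (z w : Fin N → ℂ)
    (α γ : Fin M → ℂ) (x : Fin N → Fin M) : ℂ :=
  doubleRowProd t s z w α γ (fun _ => 1) (holes x)

/-- The function `h_μ(z|α|γ)` with leading factor `z + c`; the signs `±` of the
Whittaker functions are `c = ±√(-t)`. The site `i : Fin M` is the site number `i + 1`. -/
noncomputable def hFun {M : ℕ} (c : ℂ) (α γ : Fin M → ℂ) (μ : ℕ) (z : ℂ) : ℂ :=
  (z + c) *
    (∏ i : Fin M with i.val < μ, (α i + (1 - α i * γ i) * z)) *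
    (∏ i : Fin M with μ < i.val, (1 - γ i * z)) *
    ∏ i : Fin M, (1 - γ i * z⁻¹)

/-- The denominator `det_N (z_k^{N-j+1} - z_k^{-N+j-1})`, rows `j` and columns `k`. -/
noncomputable def weylDenom {N : ℕ} (z : Fin N → ℂ) : ℂ :=
  Matrix.det (Matrix.of fun j k : Fin N =>
    z k ^ ((N : ℤ) - (j : ℤ)) - z k ^ (-((N : ℤ) - (j : ℤ))))

/-- The numerator `H_{λ+δ}`, with `δ = (N-1, …, 1, 0)`. -/
noncomputable def hDet {M N : ℕ} (c : ℂ) (α γ : Fin M → ℂ) (lam : Fin N → ℕ)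
    (z : Fin N → ℂ) : ℂ :=
  Matrix.det (Matrix.of fun j k : Fin N =>
    hFun c α γ (lam j + (j.rev : ℕ)) (z k) - hFun c α γ (lam j + (j.rev : ℕ)) (z k)⁻¹)

/-- The generalized Bump-Friedberg-Hoffstein Whittaker function `o⁺_λ`, `s = √(-t)`. -/
noncomputable def oPlus {M N : ℕ} (s : ℂ) (α γ : Fin M → ℂ) (lam : Fin N → ℕ)
    (z : Fin N → ℂ) : ℂ :=
  hDet s α γ lam z / weylDenom z

/-- The generalized Bump-Friedberg-Hoffstein Whittaker function `o⁻_λ`, `s = √(-t)`. -/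
noncomputable def oMinus {M N : ℕ} (s : ℂ) (α γ : Fin M → ℂ) (lam : Fin N → ℕ)
    (z : Fin N → ℂ) : ℂ :=
  hDet (-s) α γ lam z / weylDenom z

/-- The Bump-Friedberg-Hoffstein Whittaker function, `s = √(-t)`. -/
noncomputable def bfhWhittaker {N : ℕ} (s : ℂ) (lam : Fin N → ℕ) (z : Fin N → ℂ) : ℂ :=
  Matrix.det (Matrix.of fun j k : Fin N =>
    z k ^ (lam j + (j.rev : ℕ)) * (z k + s)
      - (z k)⁻¹ ^ (lam j + (j.rev : ℕ)) * ((z k)⁻¹ + s)) / weylDenom z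

/-- The factor `∏_j z_j^{j-1/2-N} (1 - √(-t) z_j) ∏_{j<k} (1 + t z_j z_k)(1 + t z_j z_k⁻¹)`
with `s = √(-t)`, `w_j = z_j^{1/2}`; the index `j : Fin N` is the number `j + 1`, so that
`z_j^{j-1/2-N}` is the power `2 (j + 1) - 1 - 2 N` of `w_j`. -/
noncomputable def prefactorII {N : ℕ} (t s : ℂ) (z w : Fin N → ℂ) : ℂ :=
  (∏ j : Fin N, w j ^ (2 * ((j : ℤ) + 1) - 1 - 2 * (N : ℤ)) * (1 - s * z j)) *
    ∏ j : Fin N, ∏ k ∈ Finset.Ioi j, (1 + t * z j * z k) * (1 + t * z j * (z k)⁻¹)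

/-- The relation `λ_j = x_{N-j+1} - N + j - 1` for `j = 1, …, N` between particle positions
and Young diagrams; `j : Fin N` and `x i : Fin M` are the numbers `j + 1` and `x i + 1`. -/
def IsDiagramOf {M N : ℕ} (lam : Fin N → ℕ) (x : Fin N → Fin M) : Prop :=
  ∀ j : Fin N, (lam j : ℤ) = ((x j.rev : ℤ) + 1) - (N : ℤ) + ((j : ℤ) + 1) - 1

end ReflectingIce

namespace ReflectingIce

open Function Matrix

/-! The model is free-fermionic: the weights of both `L`-operators satisfy `a₁a₂ + b₁b₂ = c₁c₂`.
After a Jordan-Wigner transformation, each `L`-operator therefore carries a creation operator,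
linear in the modes of the auxiliary line and of the sites, to another such operator. The wave with
parameter `u` is an explicit amplitude that each row transports with a scalar factor on its site
modes, the rest being an amplitude on the auxiliary line (`monodromy_auxCreate`,
`monodromyTilde_auxCreate`).

Reading off auxiliary components gives exchange relations of `A`, `B`, `Ã`, `B̃` with `create (wave
α γ u)`. In the double row operator the only unwanted term is a multiple of `B̃ B`. The diagonal
`K`-matrix makes its coefficient factor so that it cancels between the waves at `u` and `u⁻¹` when
these are combined into `standingWave`. Hence `𝓑(z)` exchanges with `create (standingWave α γ s u)`
up to a scalar (`doubleRowB_standingWave`), and `𝓑(z)` applied to the vacuum is proportional to the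
one-particle standing wave at `z` (`doubleRowB_vacuum`).

Consequently `𝓑(z_1) ⋯ 𝓑(z_N)|0^M⟩` is a scalar times a Slater state of standing waves, whose
components are the determinants `hDet` (`foldr_create_particles`, `hDet_eq_foldr_create`). The
scalar is the prefactor over the Weyl denominator, because that denominator is a Vandermonde
determinant in `z + z⁻¹` (`weylDenom_eq`).

The dual statement follows from particle-hole symmetry. Transposing and flipping all spins exchanges
the two monodromies and sends `(z, s, α, γ)` to `((tz)⁻¹, -s, -α, -γ)`, with powers of `t` governed
by particle conservation (`doubleRowB_flip`, `prod_flip`). The quotient of determinants is unchanged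
when its variables are inverted and reversed (`hDet_div_weylDenom_inv_rev`). The third claim is the
case `α = γ = 0`. -/

/-- The sign `(-1)^a`. -/
def parity (a : Fin 2) : ℂ := if a = 0 then 1 else -1

@[simp] lemma parity_zero : parity 0 = 1 := rfl

@[simp] lemma parity_one : parity 1 = -1 := by simp [parity]

/-! ### Jordan-Wigner signs and fermionic modes. -/

/-- The Jordan-Wigner sign of the first `n` sites. -/
def jwSign {M : ℕ} (n : ℕ) (s : Config M) : ℂ := ∏ i : Fin M with i.val < n, parity (s i)

lemma jwSign_zero {M : ℕ} (s : Config M) : jwSign 0 s = 1 := by simp [jwSign]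

lemma jwSign_update_of_le {M : ℕ} {n : ℕ} {k : Fin M} (h : n ≤ k.val) (s : Config M) (τ : Fin 2) :
    jwSign n (update s k τ) = jwSign n s := by
  refine Finset.prod_congr rfl fun i hi => ?_
  have : i ≠ k := by
    rintro rfl
    simp at hi
    omega
  simp [update_of_ne this]

lemma jwSign_update_of_lt {M : ℕ} {n : ℕ} {k : Fin M} (h : k.val < n) (s : Config M) (τ : Fin 2) :
    jwSign n (update s k τ) = parity (s k) * parity τ * jwSign n s := by
  have hk : k ∈ Finset.univ.filter fun i : Fin M => i.val < n := by simpa using h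
  have e : ∀ r : Config M, jwSign n r = parity (r k) *
      ∏ i ∈ (Finset.univ.filter fun i : Fin M => i.val < n).erase k, parity (r i) := fun r =>
    (Finset.mul_prod_erase _ _ hk).symm
  rw [e, e s]
  have : ∏ i ∈ (Finset.univ.filter fun i : Fin M => i.val < n).erase k, parity (update s k τ i)
      = ∏ i ∈ (Finset.univ.filter fun i : Fin M => i.val < n).erase k, parity (s i) := by
    refine Finset.prod_congr rfl fun i hi => ?_
    rw [update_of_ne (Finset.ne_of_mem_erase hi)]
  rw [this, update_self]
  have : parity (s k) * parity (s k) = 1 := by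
    unfold parity; split_ifs <;> norm_num
  linear_combination (-parity τ *
    ∏ i ∈ (Finset.univ.filter fun i : Fin M => i.val < n).erase k, parity (s i)) * this

lemma jwSign_succ {M : ℕ} (k : Fin M) (s : Config M) :
    jwSign (k.val + 1) s = parity (s k) * jwSign k.val s := by
  have : (Finset.univ.filter fun i : Fin M => i.val < k.val + 1)
      = insert k (Finset.univ.filter fun i : Fin M => i.val < k.val) := by
    ext i
    simp [Fin.ext_iff]
    omega
  rw [jwSign, this, Finset.prod_insert (by simp)]
  rfl

/-- The creation operator of the one-particle state `v`. -/
def create {M : ℕ} (v : Fin M → ℂ) (f : Config M → ℂ) : Config M → ℂ := fun s =>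
  ∑ j, if s j = 1 then v j * jwSign j s * f (update s j 0) else 0

/-- The creation operator of the site `j` on `W_a ⊗ V₁ ⊗ ⋯ ⊗ V_M`, when `a` is placed before
the site number `n` in the Jordan-Wigner order. -/
def siteMode {M : ℕ} (n : ℕ) (j : Fin M) (f : Fin 2 × Config M → ℂ) : Fin 2 × Config M → ℂ :=
  fun q => if q.2 j = 1 then
    jwSign j q.2 * (if n ≤ j.val then parity q.1 else 1) * f (q.1, update q.2 j 0) else 0

/-- The creation operator of the auxiliary space, when it is placed before the site
number `n` in the Jordan-Wigner order. -/
def auxMode {M : ℕ} (n : ℕ) (f : Fin 2 × Config M → ℂ) : Fin 2 × Config M → ℂ :=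
  fun q => if q.1 = 1 then jwSign n q.2 * f (0, q.2) else 0

/-- The creation operator of a one-particle state on `W_a ⊗ V₁ ⊗ ⋯ ⊗ V_M`. -/
def auxCreate {M : ℕ} (n : ℕ) (p : ℂ) (v : Fin M → ℂ) (f : Fin 2 × Config M → ℂ) :
    Fin 2 × Config M → ℂ :=
  p • auxMode n f + ∑ j, v j • siteMode n j f

/-! ### Six-vertex matrices and their exchange with modes. -/

/-- The six-vertex matrix. -/
def sixVertex (a₁ a₂ b₁ b₂ c₁ c₂ : ℂ) : Matrix (Fin 2 × Fin 2) (Fin 2 × Fin 2) ℂ :=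
  onPair !![a₁, 0, 0, 0;
            0, b₁, c₁, 0;
            0, c₂, b₂, 0;
            0, 0, 0, a₂]

lemma atSite_mulVec {M : ℕ} (k : Fin M) (A : Matrix (Fin 2 × Fin 2) (Fin 2 × Fin 2) ℂ)
    (f : Fin 2 × Config M → ℂ) (a : Fin 2) (s : Config M) :
    (atSite k A *ᵥ f) (a, s) = ∑ b, ∑ τ, A (a, s k) (b, τ) * f (b, update s k τ) := by
  simp only [mulVec, dotProduct, Fintype.sum_prod_type]
  refine Finset.sum_congr rfl fun b _ => ?_
  have h : ∀ r : Config M, atSite k A (a, s) (b, r) * f (b, r) =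
      ∑ τ, if r = update s k τ then A (a, s k) (b, τ) * f (b, r) else 0 := by
    intro r
    simp only [atSite]
    split_ifs with h
    · have hr : ∀ τ, r = update s k τ ↔ r k = τ := by
        intro τ
        constructor
        · intro e; rw [e]; simp
        · intro e
          ext1 i
          by_cases hi : i = k
          · subst hi; simp [e]
          · rw [update_of_ne hi, h i hi]
      simp [hr]
    · rw [zero_mul, Finset.sum_eq_zero]
      intro τ _
      rw [if_neg]
      rintro rfl
      exact h fun i hi => by simp [update_of_ne hi]
  simp_rw [h]
  rw [Finset.sum_comm]
  simp

section SixVertex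

variable {M : ℕ} (k : Fin M) (a₁ a₂ b₁ b₂ c₁ c₂ : ℂ) (f : Fin 2 × Config M → ℂ) (s : Config M)

lemma sixVertex_mulVec_zero_zero (h : s k = 0) :
    (atSite k (sixVertex a₁ a₂ b₁ b₂ c₁ c₂) *ᵥ f) (0, s) = a₁ * f (0, s) := by
  have e : update s k 0 = s := by rw [← h]; simp
  rw [atSite_mulVec]
  simp [Fin.sum_univ_two, h, sixVertex, onPair, finProdFinEquiv, e]

lemma sixVertex_mulVec_zero_one (h : s k = 1) :
    (atSite k (sixVertex a₁ a₂ b₁ b₂ c₁ c₂) *ᵥ f) (0, s) =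
      b₁ * f (0, s) + c₁ * f (1, update s k 0) := by
  have e : update s k 1 = s := by rw [← h]; simp
  rw [atSite_mulVec]
  simp [Fin.sum_univ_two, h, sixVertex, onPair, finProdFinEquiv, e]

lemma sixVertex_mulVec_one_zero (h : s k = 0) :
    (atSite k (sixVertex a₁ a₂ b₁ b₂ c₁ c₂) *ᵥ f) (1, s) =
      c₂ * f (0, update s k 1) + b₂ * f (1, s) := by
  have e : update s k 0 = s := by rw [← h]; simp
  rw [atSite_mulVec]
  simp [Fin.sum_univ_two, h, sixVertex, onPair, finProdFinEquiv, e]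

lemma sixVertex_mulVec_one_one (h : s k = 1) :
    (atSite k (sixVertex a₁ a₂ b₁ b₂ c₁ c₂) *ᵥ f) (1, s) = a₂ * f (1, s) := by
  have e : update s k 1 = s := by rw [← h]; simp
  rw [atSite_mulVec]
  simp [Fin.sum_univ_two, h, sixVertex, onPair, finProdFinEquiv, e]

end SixVertex

lemma fin_two_cases (a : Fin 2) : a = 0 ∨ a = 1 := by fin_cases a <;> simp

/-- A mode left of `k` sees neither the auxiliary line nor site `k` in its sign. A mode right of `k`
sees both, and the six-vertex matrix conserves their joint parity. Moving the auxiliary line across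
site `k` is thus invisible to it. -/
lemma sixVertex_siteMode_of_ne {M : ℕ} {j k : Fin M} (hjk : j ≠ k) (a₁ a₂ b₁ b₂ c₁ c₂ : ℂ)
    {m n : ℕ} (hm : m = k ∨ m = k + 1) (hn : n = k ∨ n = k + 1)
    (f : Fin 2 × Config M → ℂ) :
    atSite k (sixVertex a₁ a₂ b₁ b₂ c₁ c₂) *ᵥ siteMode m j f =
      siteMode n j (atSite k (sixVertex a₁ a₂ b₁ b₂ c₁ c₂) *ᵥ f) := by
  have hv : j.val ≠ k.val := fun h => hjk (Fin.ext h)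
  ext ⟨a, s⟩
  have hu : ∀ τ τ', update (update s k τ) j τ' = update (update s j τ') k τ := fun τ τ' =>
    update_comm hjk.symm _ _ _
  have hk : ∀ τ, update s j τ k = s k := fun τ => update_of_ne hjk.symm _ _
  have hj : ∀ τ, update s k τ j = s j := fun τ => update_of_ne hjk _ _
  rcases lt_or_gt_of_ne hv with h | h
  · have e1 : ¬ m ≤ j.val := by omega
    have e2 : ¬ n ≤ j.val := by omega
    have e3 : ∀ τ, jwSign j.val (update s k τ) = jwSign j.val s := fun τ =>
      jwSign_update_of_le h.le s τ
    rcases fin_two_cases a with rfl | rfl <;> rcases fin_two_cases (s k) with hs | hs <;>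
    rcases fin_two_cases (s j) with hs' | hs' <;>
    simp [sixVertex_mulVec_zero_zero, sixVertex_mulVec_zero_one, sixVertex_mulVec_one_zero,
      sixVertex_mulVec_one_one, siteMode, hs, hs', hk, hj, hu, e1, e2, e3] <;> ring
  · have e1 : m ≤ j.val := by omega
    have e2 : n ≤ j.val := by omega
    have e3 : ∀ τ, jwSign j.val (update s k τ) = parity (s k) * parity τ * jwSign j.val s :=
      fun τ => jwSign_update_of_lt h s τ
    rcases fin_two_cases a with rfl | rfl <;> rcases fin_two_cases (s k) with hs | hs <;>
    rcases fin_two_cases (s j) with hs' | hs' <;>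
    simp [sixVertex_mulVec_zero_zero, sixVertex_mulVec_zero_one, sixVertex_mulVec_one_zero,
      sixVertex_mulVec_one_one, siteMode, hs, hs', hk, hj, hu, e1, e2, e3] <;> ring

/-- The relations under which a six-vertex matrix intertwines the one-particle states
`(p, v)` and `(p', v')` of `W ⊗ V`. -/
structure Intertwines (a₁ a₂ b₁ b₂ c₁ c₂ p v p' v' : ℂ) : Prop where
  site : b₁ * v + c₁ * p = v' * a₁
  aux : c₂ * v + b₂ * p = p' * a₁
  pair_left : a₂ * p = c₂ * v' - b₁ * p'
  pair_right : a₂ * v = c₁ * p' - b₂ * v'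

/-- Each of the four occupations of line and site gives one check: nothing for the empty pair,
`site` and `aux` for one particle, and the two `pair` relations together for two. If `a₁ ≠ 0`, the
first two relations determine `(p', v')`, and the free-fermion condition implies the other two. -/
lemma sixVertex_modes {M : ℕ} (k : Fin M) {a₁ a₂ b₁ b₂ c₁ c₂ p v p' v' : ℂ}
    (h : Intertwines a₁ a₂ b₁ b₂ c₁ c₂ p v p' v') (f : Fin 2 × Config M → ℂ) :
    atSite k (sixVertex a₁ a₂ b₁ b₂ c₁ c₂) *ᵥ (p • auxMode k f + v • siteMode k k f) =
      p' • auxMode (k + 1) (atSite k (sixVertex a₁ a₂ b₁ b₂ c₁ c₂) *ᵥ f) +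
        v' • siteMode (k + 1) k (atSite k (sixVertex a₁ a₂ b₁ b₂ c₁ c₂) *ᵥ f) := by
  obtain ⟨h1, h2, h3, h4⟩ := h
  ext ⟨a, s⟩
  have e3 : ∀ τ, jwSign k.val (update s k τ) = jwSign k.val s := fun τ =>
    jwSign_update_of_le le_rfl s τ
  rcases fin_two_cases a with rfl | rfl <;> rcases fin_two_cases (s k) with hs | hs <;>
    simp [sixVertex_mulVec_zero_zero, sixVertex_mulVec_zero_one, sixVertex_mulVec_one_zero,
      sixVertex_mulVec_one_one, siteMode, auxMode, hs, jwSign_succ, e3]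
  · linear_combination jwSign k.val s * f (0, update s k 0) * h1
  · have e : update s k 0 = s := by rw [← hs]; simp
    rw [e]
    linear_combination jwSign k.val s * f (0, s) * h2
  · have e : update s k 1 = s := by rw [← hs]; simp
    rw [e]
    linear_combination jwSign k.val s * f (0, s) * h3 - jwSign k.val s * f (1, update s k 0) * h4

/-- The auxiliary line now crosses the site from right to left. Only the overall sign in the doubly
occupied sector changes, so the same relations suffice. -/
lemma sixVertex_modes_reverse {M : ℕ} (k : Fin M) {a₁ a₂ b₁ b₂ c₁ c₂ p v p' v' : ℂ}
    (h : Intertwines a₁ a₂ b₁ b₂ c₁ c₂ p v p' v') (f : Fin 2 × Config M → ℂ) :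
    atSite k (sixVertex a₁ a₂ b₁ b₂ c₁ c₂) *ᵥ (p • auxMode (k + 1) f + v • siteMode (k + 1) k f) =
      p' • auxMode k (atSite k (sixVertex a₁ a₂ b₁ b₂ c₁ c₂) *ᵥ f) +
        v' • siteMode k k (atSite k (sixVertex a₁ a₂ b₁ b₂ c₁ c₂) *ᵥ f) := by
  obtain ⟨h1, h2, h3, h4⟩ := h
  ext ⟨a, s⟩
  have e3 : ∀ τ, jwSign k.val (update s k τ) = jwSign k.val s := fun τ =>
    jwSign_update_of_le le_rfl s τ
  rcases fin_two_cases a with rfl | rfl <;> rcases fin_two_cases (s k) with hs | hs <;>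
    simp [sixVertex_mulVec_zero_zero, sixVertex_mulVec_zero_one, sixVertex_mulVec_one_zero,
      sixVertex_mulVec_one_one, siteMode, auxMode, hs, jwSign_succ, e3]
  · linear_combination jwSign k.val s * f (0, update s k 0) * h1
  · have e : update s k 0 = s := by rw [← hs]; simp
    rw [e]
    linear_combination jwSign k.val s * f (0, s) * h2
  · have e : update s k 1 = s := by rw [← hs]; simp
    rw [e]
    linear_combination -jwSign k.val s * f (0, s) * h3 + jwSign k.val s * f (1, update s k 0) * h4

/-- The vector `|b⟩_a ⊗ g`. -/
def auxTensor {M : ℕ} (b : Fin 2) (g : Config M → ℂ) : Fin 2 × Config M → ℂ :=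
  fun q => if q.1 = b then g q.2 else 0

lemma auxEntry_mulVec {M : ℕ} (a b : Fin 2) (T : AuxOp M) (g : Config M → ℂ) :
    auxEntry a b T *ᵥ g = fun s => (T *ᵥ auxTensor b g) (a, s) := by
  ext s
  simp only [mulVec, dotProduct, Fintype.sum_prod_type, auxEntry, auxTensor]
  rw [Finset.sum_eq_single b] <;> simp +contextual

section Linearity

variable {M : ℕ}

lemma create_smul (v : Fin M → ℂ) (c : ℂ) (f : Config M → ℂ) :
    create v (c • f) = c • create v f := by
  ext s
  simp only [create, Pi.smul_apply, smul_eq_mul, Finset.mul_sum, mul_ite, mul_zero]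
  exact Finset.sum_congr rfl fun j _ => by split_ifs <;> ring

lemma create_add (v : Fin M → ℂ) (f g : Config M → ℂ) :
    create v (f + g) = create v f + create v g := by
  ext s
  simp only [create, Pi.add_apply, ← Finset.sum_add_distrib]
  exact Finset.sum_congr rfl fun j _ => by split_ifs <;> ring

lemma create_smul_left (v : Fin M → ℂ) (c : ℂ) (f : Config M → ℂ) :
    create (c • v) f = c • create v f := by
  ext s
  simp only [create, Pi.smul_apply, smul_eq_mul, Finset.mul_sum, mul_ite, mul_zero]
  exact Finset.sum_congr rfl fun j _ => by split_ifs <;> ring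

lemma create_sub_left (v w : Fin M → ℂ) (f : Config M → ℂ) :
    create (v - w) f = create v f - create w f := by
  ext s
  simp only [create, Pi.sub_apply, ← Finset.sum_sub_distrib]
  exact Finset.sum_congr rfl fun j _ => by split_ifs <;> ring

lemma siteMode_smul (n : ℕ) (j : Fin M) (c : ℂ) (f : Fin 2 × Config M → ℂ) :
    siteMode n j (c • f) = c • siteMode n j f := by
  ext q
  simp only [siteMode, Pi.smul_apply, smul_eq_mul]
  split_ifs <;> ring

end Linearity

/-! ### Creation operators on the auxiliary line together with the sites. -/

section AuxCreate

variable {M : ℕ} (n : ℕ) (p : ℂ) (v : Fin M → ℂ)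

lemma auxCreate_apply_zero (f : Fin 2 × Config M → ℂ) (s : Config M) :
    auxCreate n p v f (0, s) = create v (fun r => f (0, r)) s := by
  simp [auxCreate, create, auxMode, siteMode, Finset.sum_apply, mul_assoc]

lemma auxCreate_zero_apply_one (f : Fin 2 × Config M → ℂ) (s : Config M) :
    auxCreate 0 p v f (1, s) = p * f (0, s) - create v (fun r => f (1, r)) s := by
  simp [auxCreate, create, auxMode, siteMode, Finset.sum_apply, mul_assoc, jwSign_zero,
    sub_eq_add_neg, ← Finset.sum_neg_distrib, apply_ite]

lemma auxCreate_last_apply_one (f : Fin 2 × Config M → ℂ) (s : Config M) :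
    auxCreate M p v f (1, s) = p * jwSign M s * f (0, s) + create v (fun r => f (1, r)) s := by
  have : ∀ j : Fin M, ¬ M ≤ j.val := fun j => by omega
  simp [auxCreate, create, auxMode, siteMode, Finset.sum_apply, mul_assoc, this]

lemma create_zero_right (v : Fin M → ℂ) : create v (fun _ => 0) = 0 := by
  ext s; simp [create]

lemma auxCreate_zero_auxTensor_zero (g : Config M → ℂ) :
    auxCreate 0 p v (auxTensor 0 g) = auxTensor 0 (create v g) + p • auxTensor 1 g := by
  ext ⟨a, s⟩
  rcases fin_two_cases a with rfl | rfl
  · simp [auxCreate_apply_zero, auxTensor]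
  · simp [auxCreate_zero_apply_one, auxTensor, create_zero_right]

lemma auxCreate_zero_auxTensor_one (g : Config M → ℂ) :
    auxCreate 0 p v (auxTensor 1 g) = (-1 : ℂ) • auxTensor 1 (create v g) := by
  ext ⟨a, s⟩
  rcases fin_two_cases a with rfl | rfl
  · simp [auxCreate_apply_zero, auxTensor, create_zero_right]
  · simp [auxCreate_zero_apply_one, auxTensor]

lemma auxCreate_last_auxTensor_one (g : Config M → ℂ) :
    auxCreate M p v (auxTensor 1 g) = auxTensor 1 (create v g) := by
  ext ⟨a, s⟩
  rcases fin_two_cases a with rfl | rfl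
  · simp [auxCreate_apply_zero, auxTensor, create_zero_right]
  · simp [auxCreate_last_apply_one, auxTensor]

lemma auxCreate_eq_erase (k : Fin M) (f : Fin 2 × Config M → ℂ) :
    auxCreate n p v f = (p • auxMode n f + v k • siteMode n k f) +
      ∑ j ∈ Finset.univ.erase k, v j • siteMode n j f := by
  rw [auxCreate, add_assoc, Finset.add_sum_erase _ (fun j => v j • siteMode n j f)
    (Finset.mem_univ k)]

end AuxCreate

section Intertwining

variable {M : ℕ} (k : Fin M) {a₁ a₂ b₁ b₂ c₁ c₂ p p' : ℂ} {v v' : Fin M → ℂ}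

lemma sixVertex_auxCreate (h : Intertwines a₁ a₂ b₁ b₂ c₁ c₂ p (v k) p' (v' k))
    (hv : ∀ j, j ≠ k → v' j = v j) (f : Fin 2 × Config M → ℂ) :
    atSite k (sixVertex a₁ a₂ b₁ b₂ c₁ c₂) *ᵥ auxCreate k p v f =
      auxCreate (k + 1) p' v' (atSite k (sixVertex a₁ a₂ b₁ b₂ c₁ c₂) *ᵥ f) := by
  rw [auxCreate_eq_erase _ _ _ k, auxCreate_eq_erase _ _ _ k, mulVec_add, sixVertex_modes k h,
    mulVec_sum]
  congr 1
  refine Finset.sum_congr rfl fun j hj => ?_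
  have hj := Finset.ne_of_mem_erase hj
  rw [mulVec_smul, sixVertex_siteMode_of_ne hj _ _ _ _ _ _ (Or.inl rfl) (Or.inr rfl), hv j hj]

lemma sixVertex_auxCreate_reverse (h : Intertwines a₁ a₂ b₁ b₂ c₁ c₂ p (v k) p' (v' k))
    (hv : ∀ j, j ≠ k → v' j = v j) (f : Fin 2 × Config M → ℂ) :
    atSite k (sixVertex a₁ a₂ b₁ b₂ c₁ c₂) *ᵥ auxCreate (k + 1) p v f =
      auxCreate k p' v' (atSite k (sixVertex a₁ a₂ b₁ b₂ c₁ c₂) *ᵥ f) := by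
  rw [auxCreate_eq_erase _ _ _ k, auxCreate_eq_erase _ _ _ k, mulVec_add,
    sixVertex_modes_reverse k h, mulVec_sum]
  congr 1
  refine Finset.sum_congr rfl fun j hj => ?_
  have hj := Finset.ne_of_mem_erase hj
  rw [mulVec_smul, sixVertex_siteMode_of_ne hj _ _ _ _ _ _ (Or.inr rfl) (Or.inl rfl), hv j hj]

/-- The vacuum `|0^M⟩`. -/
def vacuum (M : ℕ) : Config M → ℂ := fun s => if s = 0 then 1 else 0

lemma sixVertex_vacuum : atSite k (sixVertex a₁ a₂ b₁ b₂ c₁ c₂) *ᵥ auxTensor 0 (vacuum M) =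
    a₁ • auxTensor 0 (vacuum M) := by
  ext ⟨a, s⟩
  have h1 : s k = 1 → s ≠ 0 := by rintro h rfl; simp at h
  have h2 : update s k 1 ≠ 0 := fun h => by simpa using congrFun h k
  rcases fin_two_cases a with rfl | rfl <;> rcases fin_two_cases (s k) with hs | hs <;>
    simp [sixVertex_mulVec_zero_zero, sixVertex_mulVec_zero_one, sixVertex_mulVec_one_zero,
      sixVertex_mulVec_one_one, hs, auxTensor, vacuum, h1, h2]

/-- Over the vacuum only the one-particle sector occurs, so no relation between the weights is
needed, and the Jordan-Wigner position is immaterial. -/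
lemma sixVertex_modes_vacuum {m n : ℕ} (hm : m = k ∨ m = k + 1) (hn : n = k ∨ n = k + 1)
    (p v : ℂ) :
    atSite k (sixVertex a₁ a₂ b₁ b₂ c₁ c₂) *ᵥ
        (p • auxMode m (auxTensor 0 (vacuum M)) + v • siteMode m k (auxTensor 0 (vacuum M))) =
      (c₂ * v + b₂ * p) • auxMode n (auxTensor 0 (vacuum M)) +
        (b₁ * v + c₁ * p) • siteMode n k (auxTensor 0 (vacuum M)) := by
  ext ⟨a, s⟩
  have h1 : s k = 1 → s ≠ 0 := by rintro h rfl; simp at h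
  have h2 : update s k 1 ≠ 0 := fun h => by simpa using congrFun h k
  have h0 : s k = 0 → update s k 0 = s := fun h => by rw [← h]; simp
  have e3 : ∀ τ, jwSign k.val (update s k τ) = jwSign k.val s := fun τ =>
    jwSign_update_of_le le_rfl s τ
  rcases hm with rfl | rfl <;> rcases hn with rfl | rfl <;>
  rcases fin_two_cases a with rfl | rfl <;> rcases fin_two_cases (s k) with hs | hs <;>
    simp [sixVertex_mulVec_zero_zero, sixVertex_mulVec_zero_one, sixVertex_mulVec_one_zero,
      sixVertex_mulVec_one_one, siteMode, auxMode, hs, auxTensor, vacuum, h1, jwSign_succ,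
      e3, h0] <;> split_ifs <;> ring

lemma sixVertex_auxCreate_vacuum {m n : ℕ} (hm : m = k ∨ m = k + 1) (hn : n = k ∨ n = k + 1)
    (hp : p' = c₂ * v k + b₂ * p) (hk : v' k = b₁ * v k + c₁ * p)
    (hv : ∀ j, j ≠ k → v' j = a₁ * v j) :
    atSite k (sixVertex a₁ a₂ b₁ b₂ c₁ c₂) *ᵥ auxCreate m p v (auxTensor 0 (vacuum M)) =
      auxCreate n p' v' (auxTensor 0 (vacuum M)) := by
  rw [auxCreate_eq_erase _ _ _ k, auxCreate_eq_erase _ _ _ k, mulVec_add,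
    sixVertex_modes_vacuum k hm hn, mulVec_sum, hp, hk]
  congr 1
  refine Finset.sum_congr rfl fun j hj => ?_
  have hj := Finset.ne_of_mem_erase hj
  rw [mulVec_smul, sixVertex_siteMode_of_ne hj _ _ _ _ _ _ hm hn, hv j hj, sixVertex_vacuum,
    siteMode_smul, smul_smul, mul_comm]

end Intertwining

/-! ### Transport through an ordered product of matrices. -/

section Telescoping

variable {ι : Type*} [Fintype ι] [DecidableEq ι]

lemma reverse_prod_mulVec_telescope {m : ℕ} (F : Fin m → Matrix ι ι ℂ) (X : ℕ → (ι → ℂ) → ι → ℂ)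
    (h : ∀ (k : Fin m) f, F k *ᵥ X k f = X (k + 1) (F k *ᵥ f)) (f : ι → ℂ) :
    (List.ofFn F).reverse.prod *ᵥ X 0 f = X m ((List.ofFn F).reverse.prod *ᵥ f) := by
  induction m with
  | zero => simp
  | succ m ih =>
    rw [List.ofFn_succ', List.concat_eq_append, List.reverse_append, List.reverse_singleton,
      List.singleton_append, List.prod_cons, ← mulVec_mulVec, ← mulVec_mulVec,
      ih _ fun k f => h k.castSucc f]
    exact h (Fin.last m) _

lemma prod_mulVec_telescope {m : ℕ} (F : Fin m → Matrix ι ι ℂ) (X : ℕ → (ι → ℂ) → ι → ℂ)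
    (h : ∀ (k : Fin m) f, F k *ᵥ X (k + 1) f = X k (F k *ᵥ f)) (f : ι → ℂ) :
    (List.ofFn F).prod *ᵥ X m f = X 0 ((List.ofFn F).prod *ᵥ f) := by
  induction m generalizing f with
  | zero => simp
  | succ m ih =>
    rw [List.ofFn_succ', List.concat_eq_append, List.prod_append, List.prod_singleton,
      ← mulVec_mulVec, ← mulVec_mulVec]
    have := h (Fin.last m) f
    simp only [Fin.val_last] at this
    rw [this, ih _ fun k f => h k.castSucc f]

lemma reverse_prod_mulVec_states {m : ℕ} (F : Fin m → Matrix ι ι ℂ) (x : ℕ → ι → ℂ)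
    (h : ∀ k : Fin m, F k *ᵥ x k = x (k + 1)) : (List.ofFn F).reverse.prod *ᵥ x 0 = x m := by
  induction m with
  | zero => simp
  | succ m ih =>
    rw [List.ofFn_succ', List.concat_eq_append, List.reverse_append, List.reverse_singleton,
      List.singleton_append, List.prod_cons, ← mulVec_mulVec, ih _ fun k => h k.castSucc]
    exact h (Fin.last m)

lemma prod_mulVec_states {m : ℕ} (F : Fin m → Matrix ι ι ℂ) (x : ℕ → ι → ℂ)
    (h : ∀ k : Fin m, F k *ᵥ x (k + 1) = x k) : (List.ofFn F).prod *ᵥ x m = x 0 := by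
  induction m with
  | zero => simp
  | succ m ih =>
    rw [List.ofFn_succ', List.concat_eq_append, List.prod_append, List.prod_singleton,
      ← mulVec_mulVec]
    have := h (Fin.last m)
    simp only [Fin.val_last] at this
    rw [this]
    exact ih _ fun k => h k.castSucc

end Telescoping

section FilteredProducts

variable {M : ℕ} (F : Fin M → ℂ) (k : Fin M)

lemma prod_lt_succ : (∏ i : Fin M with i.val < k.val + 1, F i) =
    F k * ∏ i : Fin M with i.val < k.val, F i := by
  rw [← Finset.prod_insert (by simp)]
  refine Finset.prod_congr ?_ fun _ _ => rfl
  ext i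
  simp [Fin.ext_iff]
  omega

lemma prod_ge : (∏ i : Fin M with k.val ≤ i.val, F i) =
    F k * ∏ i : Fin M with k.val < i.val, F i := by
  rw [← Finset.prod_insert (by simp)]
  refine Finset.prod_congr ?_ fun _ _ => rfl
  ext i
  simp [Fin.ext_iff]
  omega

lemma prod_between_succ {j : Fin M} (h : j.val < k.val) :
    (∏ i : Fin M with j.val < i.val ∧ i.val < k.val + 1, F i) =
      F k * ∏ i : Fin M with j.val < i.val ∧ i.val < k.val, F i := by
  rw [← Finset.prod_insert (by simp)]
  refine Finset.prod_congr ?_ fun _ _ => rfl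
  ext i
  simp [Fin.ext_iff]
  omega

lemma prod_between_pred {j : Fin M} (h : k.val < j.val) :
    (∏ i : Fin M with k.val ≤ i.val ∧ i.val < j.val, F i) =
      F k * ∏ i : Fin M with k.val + 1 ≤ i.val ∧ i.val < j.val, F i := by
  rw [← Finset.prod_insert (by simp)]
  refine Finset.prod_congr ?_ fun _ _ => rfl
  ext i
  simp [Fin.ext_iff]
  omega

end FilteredProducts

/-! ### One-particle waves carried by the monodromies. -/

section Waves

variable {M : ℕ} (α γ : Fin M → ℂ)

/-- The one-particle wave with spectral parameter `u`. -/
noncomputable def wave (u : ℂ) (k : Fin M) : ℂ :=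
  (∏ i : Fin M with i.val < k.val, (α i + (1 - α i * γ i) * u)) *
    ∏ i : Fin M with k.val < i.val, (1 - γ i * u)

lemma wave_def (u : ℂ) : wave α γ u = fun k : Fin M =>
    (∏ i : Fin M with i.val < k.val, (α i + (1 - α i * γ i) * u)) *
      ∏ i : Fin M with k.val < i.val, (1 - γ i * u) := rfl

/-- The amplitude of the wave on the auxiliary line before the site number `n`. -/
noncomputable def edgeWave (u : ℂ) (n : ℕ) : ℂ :=
  (∏ i : Fin M with i.val < n, (α i + (1 - α i * γ i) * u)) *
    ∏ i : Fin M with n ≤ i.val, (1 - γ i * u)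

lemma edgeWave_eq (u : ℂ) (k : Fin M) :
    edgeWave α γ u k = (1 - γ k * u) * wave α γ u k := by
  rw [edgeWave, wave, prod_ge fun i => 1 - γ i * u]
  ring

lemma edgeWave_succ (u : ℂ) (k : Fin M) :
    edgeWave α γ u (k + 1) = (α k + (1 - α k * γ k) * u) * wave α γ u k := by
  rw [edgeWave, wave, prod_lt_succ fun i => α i + (1 - α i * γ i) * u]
  simp only [Nat.succ_le_iff]
  ring

/-- The product of `1 - γ_i u` over all sites. -/
noncomputable def holeWeight (u : ℂ) : ℂ := ∏ i : Fin M, (1 - γ i * u)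

lemma edgeWave_zero (u : ℂ) : edgeWave α γ u 0 = holeWeight γ u := by
  simp [edgeWave, holeWeight]

lemma gammaL_eq (y t α γ : ℂ) : gammaL y t α γ = sixVertex (1 - γ * y)
    (-t * α + (1 - α * γ) * y) (t + γ * y) (α + (1 - α * γ) * y) 1 ((t + 1) * y) := rfl

lemma deltaL_eq (z t α γ : ℂ) : deltaL z t α γ = sixVertex (α + (1 - α * γ) * z)
    (t * γ * z + 1) (t * (1 - α * γ) * z - α) (1 - γ * z) 1 ((t + 1) * z) := rfl

/-- The sites already crossed carry the factor `t * u + z⁻¹`, the others still `u - z⁻¹`, and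
`edgeWave` is the amplitude on the line in between. With this interpolation every single crossing is
a polynomial instance of `Intertwines`; keeping both factors avoids dividing by `u - z⁻¹`. -/
lemma monodromy_auxCreate (z t u : ℂ) (f : Fin 2 × Config M → ℂ) :
    monodromy z t α γ *ᵥ auxCreate 0 ((t + 1) * z⁻¹ * holeWeight γ u)
        ((u - z⁻¹) • wave α γ u) f =
      auxCreate M ((t + 1) * z⁻¹ * edgeWave α γ u M) ((t * u + z⁻¹) • wave α γ u)
        (monodromy z t α γ *ᵥ f) := by
  have key := reverse_prod_mulVec_telescope
    (fun j : Fin M => atSite j (gammaL z⁻¹ t (α j) (γ j)))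
    (fun n => auxCreate n ((t + 1) * z⁻¹ * edgeWave α γ u n)
      (fun j => if j.val < n then (t * u + z⁻¹) * wave α γ u j else (u - z⁻¹) * wave α γ u j)) ?_ f
  · simpa [edgeWave_zero, monodromy, Pi.smul_def] using key
  · intro k f
    rw [gammaL_eq]
    refine sixVertex_auxCreate k ?_ ?_ f
    · constructor <;> simp [edgeWave_eq, edgeWave_succ] <;> ring
    · intro j hj
      have : j.val ≠ k.val := fun h => hj (Fin.ext h)
      have : j.val < k.val + 1 ↔ j.val < k.val := by omega
      simp [this]

lemma monodromyTilde_auxCreate (z t u : ℂ) (f : Fin 2 × Config M → ℂ) :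
    monodromyTilde z t α γ *ᵥ auxCreate M ((t + 1) * z * edgeWave α γ u M)
        ((z - u) • wave α γ u) f =
      auxCreate 0 ((t + 1) * z * holeWeight γ u) ((t * z + u) • wave α γ u)
        (monodromyTilde z t α γ *ᵥ f) := by
  have key := prod_mulVec_telescope
    (fun j : Fin M => atSite j (deltaL z t (α j) (γ j)))
    (fun n => auxCreate n ((t + 1) * z * edgeWave α γ u n)
      (fun j => if j.val < n then (z - u) * wave α γ u j else (t * z + u) * wave α γ u j)) ?_ f
  · simpa [edgeWave_zero, monodromyTilde, Pi.smul_def] using key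
  · intro k f
    rw [deltaL_eq]
    refine sixVertex_auxCreate_reverse k ?_ ?_ f
    · constructor <;> simp [edgeWave_eq, edgeWave_succ] <;> ring
    · intro j hj
      have : j.val ≠ k.val := fun h => hj (Fin.ext h)
      have : j.val < k.val + 1 ↔ j.val < k.val := by omega
      simp [this]

lemma monodromy_vacuum (z t : ℂ) :
    monodromy z t α γ *ᵥ auxTensor 0 (vacuum M) = holeWeight γ z⁻¹ • auxTensor 0 (vacuum M) := by
  have key := reverse_prod_mulVec_states
    (fun j : Fin M => atSite j (gammaL z⁻¹ t (α j) (γ j)))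
    (fun n => (∏ i : Fin M with i.val < n, (1 - γ i * z⁻¹)) • auxTensor 0 (vacuum M)) ?_
  · simpa [monodromy, holeWeight] using key
  · intro k
    rw [gammaL_eq, mulVec_smul, sixVertex_vacuum, smul_smul, prod_lt_succ, mul_comm]

/-- An occupied auxiliary line over the vacuum is a one-particle state, so the one-particle
transport applies to it. -/
lemma auxTensor_one_vacuum_eq_zero :
    auxTensor 1 (vacuum M) = auxCreate 0 1 (fun _ => 0) (auxTensor 0 (vacuum M)) := by
  rw [auxCreate_zero_auxTensor_zero]
  ext ⟨a, s⟩
  simp [auxTensor, create]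

lemma auxTensor_one_vacuum_eq_last :
    auxTensor 1 (vacuum M) = auxCreate M 1 (fun _ => 0) (auxTensor 0 (vacuum M)) := by
  ext ⟨a, s⟩
  rcases fin_two_cases a with rfl | rfl
  · simp [auxCreate_apply_zero, auxTensor, create]
  · simp only [auxCreate_last_apply_one, auxTensor, create, vacuum]
    by_cases h : s = 0
    · subst h; simp [jwSign]
    · simp [h]

/-- The particle travels along the line with weight `b₂`, is deposited on a site with weight `c₁ =
1`, and every later site contributes `a₁`. These weights multiply to the wave at `z⁻¹`. -/
lemma monodromy_particle (z t : ℂ) :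
    monodromy z t α γ *ᵥ auxTensor 1 (vacuum M) =
      auxCreate M (∏ i : Fin M, (α i + (1 - α i * γ i) * z⁻¹)) (wave α γ z⁻¹)
        (auxTensor 0 (vacuum M)) := by
  have key := reverse_prod_mulVec_states
    (fun j : Fin M => atSite j (gammaL z⁻¹ t (α j) (γ j)))
    (fun n => auxCreate n (∏ i : Fin M with i.val < n, (α i + (1 - α i * γ i) * z⁻¹))
      (fun j => if j.val < n then
        (∏ i : Fin M with i.val < j.val, (α i + (1 - α i * γ i) * z⁻¹)) *
          ∏ i : Fin M with j.val < i.val ∧ i.val < n, (1 - γ i * z⁻¹) else 0)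
        (auxTensor 0 (vacuum M))) ?_
  · rw [auxTensor_one_vacuum_eq_zero]
    simpa [monodromy, wave_def] using key
  · intro k
    rw [gammaL_eq]
    refine sixVertex_auxCreate_vacuum k (Or.inl rfl) (Or.inr rfl) ?_ ?_ ?_
    · rw [prod_lt_succ]; simp
    · have : (Finset.univ.filter fun i : Fin M => k.val < i.val ∧ i.val < k.val + 1) = ∅ := by
        ext i; simp
      rw [if_pos (Nat.lt_succ_self _), this]
      simp
    · intro j hj
      have : j.val ≠ k.val := fun h => hj (Fin.ext h)
      by_cases h : j.val < k.val
      · have h' : j.val < k.val + 1 := by omega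
        simp only [h, h', if_true]
        rw [prod_between_succ _ _ h]
        ring
      · have h' : ¬ j.val < k.val + 1 := by omega
        simp only [h, h', if_false, mul_zero]

lemma monodromyTilde_particle (z t : ℂ) :
    monodromyTilde z t α γ *ᵥ auxTensor 1 (vacuum M) =
      auxCreate 0 (holeWeight γ z) (wave α γ z) (auxTensor 0 (vacuum M)) := by
  have key := prod_mulVec_states
    (fun j : Fin M => atSite j (deltaL z t (α j) (γ j)))
    (fun n => auxCreate n (∏ i : Fin M with n ≤ i.val, (1 - γ i * z))
      (fun j => if n ≤ j.val then
        (∏ i : Fin M with n ≤ i.val ∧ i.val < j.val, (α i + (1 - α i * γ i) * z)) *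
          ∏ i : Fin M with j.val < i.val, (1 - γ i * z) else 0)
        (auxTensor 0 (vacuum M))) ?_
  · rw [auxTensor_one_vacuum_eq_last]
    have hM : ∀ j : Fin M, ¬ M ≤ j.val := fun j => by omega
    -- Before the first crossing the line stands behind all sites, so every site amplitude is zero.
    simpa [monodromyTilde, wave_def, holeWeight, hM] using key
  · intro k
    rw [deltaL_eq]
    refine sixVertex_auxCreate_vacuum k (Or.inr rfl) (Or.inl rfl) ?_ ?_ ?_
    · rw [prod_ge]; simp
    · have : (Finset.univ.filter fun i : Fin M => k.val ≤ i.val ∧ i.val < k.val) = ∅ := by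
        ext i; simp
      rw [if_pos le_rfl, this]
      simp
    · intro j hj
      have : j.val ≠ k.val := fun h => hj (Fin.ext h)
      by_cases h : k.val < j.val
      · have h' : k.val ≤ j.val := by omega
        have h'' : k.val + 1 ≤ j.val := by omega
        simp only [h', h'', if_true]
        rw [prod_between_pred _ _ h]
        ring
      · have h' : ¬ k.val ≤ j.val := by omega
        have h'' : ¬ k.val + 1 ≤ j.val := by omega
        simp only [h', h'', if_false, mul_zero]

end Waves

/-! ### Exchange relations of the row operators with waves. -/

section RowOperators

variable {M : ℕ} (α γ : Fin M → ℂ) (z t u : ℂ)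

/-- The transported operator applied to `|0⟩ ⊗ g` also creates a particle on the auxiliary line;
that part produces the `B` term. -/
lemma rowA_create (g : Config M → ℂ) :
    (u - z⁻¹) • (auxEntry 0 0 (monodromy z t α γ) *ᵥ create (wave α γ u) g) =
      (t * u + z⁻¹) • create (wave α γ u) (auxEntry 0 0 (monodromy z t α γ) *ᵥ g) -
        ((t + 1) * z⁻¹ * holeWeight γ u) • (auxEntry 0 1 (monodromy z t α γ) *ᵥ g) := by
  have key := monodromy_auxCreate α γ z t u (auxTensor 0 g)
  rw [auxCreate_zero_auxTensor_zero, mulVec_add, mulVec_smul] at key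
  ext s
  have := congrFun key (0, s)
  rw [auxCreate_apply_zero, create_smul_left, create_smul_left] at this
  simp only [Pi.add_apply, Pi.smul_apply, smul_eq_mul, auxEntry_mulVec, Pi.sub_apply] at this ⊢
  rw [← this]
  have e : auxTensor 0 ((u - z⁻¹) • create (wave α γ u) g) =
      (u - z⁻¹) • auxTensor 0 (create (wave α γ u) g) := by
    ext; simp [auxTensor]
  rw [e, mulVec_smul]
  simp

/-- The auxiliary mode annihilates an occupied line, so no extra term arises. The minus sign comes
from site modes passing the occupied line. -/
lemma rowB_create (g : Config M → ℂ) :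
    (u - z⁻¹) • (auxEntry 0 1 (monodromy z t α γ) *ᵥ create (wave α γ u) g) =
      (-(t * u + z⁻¹)) • create (wave α γ u) (auxEntry 0 1 (monodromy z t α γ) *ᵥ g) := by
  have key := monodromy_auxCreate α γ z t u (auxTensor 1 g)
  rw [auxCreate_zero_auxTensor_one, mulVec_smul] at key
  ext s
  have := congrFun key (0, s)
  rw [auxCreate_apply_zero, create_smul_left, create_smul_left] at this
  simp only [Pi.smul_apply, smul_eq_mul, auxEntry_mulVec] at this ⊢
  rw [neg_mul, ← this]
  have e : auxTensor 1 ((u - z⁻¹) • create (wave α γ u) g) =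
      (u - z⁻¹) • auxTensor 1 (create (wave α γ u) g) := by
    ext; simp [auxTensor]
  rw [e, mulVec_smul]
  simp

lemma rowBTilde_create (g : Config M → ℂ) :
    (z - u) • (auxEntry 0 1 (monodromyTilde z t α γ) *ᵥ create (wave α γ u) g) =
      (t * z + u) • create (wave α γ u) (auxEntry 0 1 (monodromyTilde z t α γ) *ᵥ g) := by
  have key := monodromyTilde_auxCreate α γ z t u (auxTensor 1 g)
  rw [auxCreate_last_auxTensor_one] at key
  ext s
  have := congrFun key (0, s)
  rw [auxCreate_apply_zero, create_smul_left, create_smul_left] at this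
  simp only [Pi.smul_apply, smul_eq_mul, auxEntry_mulVec] at this ⊢
  rw [← this]
  have e : auxTensor 1 ((z - u) • create (wave α γ u) g) =
      (z - u) • auxTensor 1 (create (wave α γ u) g) := by
    ext; simp [auxTensor]
  rw [e, mulVec_smul]
  simp

/-- The extra `B̃` term is the auxiliary mode left at the front after the transport, evaluated on an
occupied line. -/
lemma rowATilde_create (g : Config M → ℂ) :
    (z - u) • (auxEntry 1 1 (monodromyTilde z t α γ) *ᵥ create (wave α γ u) g) =
      ((t + 1) * z * holeWeight γ u) • (auxEntry 0 1 (monodromyTilde z t α γ) *ᵥ g) -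
        (t * z + u) • create (wave α γ u) (auxEntry 1 1 (monodromyTilde z t α γ) *ᵥ g) := by
  have key := monodromyTilde_auxCreate α γ z t u (auxTensor 1 g)
  rw [auxCreate_last_auxTensor_one] at key
  ext s
  have := congrFun key (1, s)
  rw [auxCreate_zero_apply_one, create_smul_left, create_smul_left] at this
  simp only [Pi.smul_apply, smul_eq_mul, auxEntry_mulVec, Pi.sub_apply] at this ⊢
  rw [← this]
  have e : auxTensor 1 ((z - u) • create (wave α γ u) g) =
      (z - u) • auxTensor 1 (create (wave α γ u) g) := by
    ext; simp [auxTensor]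
  rw [e, mulVec_smul]
  simp

lemma rowA_vacuum :
    auxEntry 0 0 (monodromy z t α γ) *ᵥ vacuum M = holeWeight γ z⁻¹ • vacuum M := by
  ext s
  rw [auxEntry_mulVec, monodromy_vacuum]
  simp [auxTensor]

lemma rowB_vacuum :
    auxEntry 0 1 (monodromy z t α γ) *ᵥ vacuum M = create (wave α γ z⁻¹) (vacuum M) := by
  ext s
  simp only [auxEntry_mulVec, monodromy_particle, auxCreate_apply_zero]
  simp [auxTensor]

lemma rowBTilde_vacuum :
    auxEntry 0 1 (monodromyTilde z t α γ) *ᵥ vacuum M = create (wave α γ z) (vacuum M) := by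
  ext s
  simp only [auxEntry_mulVec, monodromyTilde_particle, auxCreate_apply_zero]
  simp [auxTensor]

lemma rowATilde_vacuum :
    auxEntry 1 1 (monodromyTilde z t α γ) *ᵥ vacuum M = holeWeight γ z • vacuum M := by
  ext s
  simp only [auxEntry_mulVec, monodromyTilde_particle, auxCreate_zero_apply_one]
  simp [auxTensor, create_zero_right]

end RowOperators

/-! ### The double row operator and standing waves. -/

section DoubleRow

variable {M : ℕ} {t s z w u : ℂ} (α γ : Fin M → ℂ)

/-- The antisymmetrized one-particle wave, a standing wave of the reflecting end. -/
noncomputable def standingWave (s : ℂ) (u : ℂ) : Fin M → ℂ :=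
  ((u + s) * holeWeight γ u⁻¹) • wave α γ u - ((u⁻¹ + s) * holeWeight γ u) • wave α γ u⁻¹

lemma standingWave_apply (s u : ℂ) (k : Fin M) :
    standingWave α γ s u k = hFun s α γ k u - hFun s α γ k u⁻¹ := by
  simp only [standingWave, hFun, wave, holeWeight, Pi.sub_apply, Pi.smul_apply, smul_eq_mul,
    inv_inv]
  ring

lemma doubleRowB_mulVec (t s z w : ℂ) (g : Config M → ℂ) :
    doubleRowB t s z w α γ *ᵥ g =
      (-s * w) • (auxEntry 0 1 (monodromyTilde z t α γ) *ᵥ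
        (auxEntry 0 0 (monodromy z t α γ) *ᵥ g)) +
      w⁻¹ • (auxEntry 1 1 (monodromyTilde z t α γ) *ᵥ
        (auxEntry 0 1 (monodromy z t α γ) *ᵥ g)) := by
  rw [doubleRowB, add_mulVec, smul_mulVec, smul_mulVec, ← mulVec_mulVec, ← mulVec_mulVec]
  simp only [kMatrixII, of_apply, cons_val_zero, cons_val_one]

/-- Passing the wave through `A` and through `Ã` each leaves a `B̃ B` term. The factor `z * u⁻¹` is
what remains after clearing denominators so that the scalars on both sides are symmetric under `u ↦
u⁻¹`. -/
lemma doubleRowB_wave (hs : s ^ 2 = -t) (hw : w ^ 2 = z) (hz : z ≠ 0) (hu : u ≠ 0)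
    (g : Config M → ℂ) :
    ((z * u - 1) * (z * u⁻¹ - 1)) • (doubleRowB t s z w α γ *ᵥ create (wave α γ u) g) =
      ((1 + t * z * u) * (1 + t * z * u⁻¹)) •
          create (wave α γ u) (doubleRowB t s z w α γ *ᵥ g) -
        (z * u⁻¹ * ((t + 1) * holeWeight γ u * w⁻¹ * (1 - s * z) * (1 + s * u))) •
          (auxEntry 0 1 (monodromyTilde z t α γ) *ᵥ
            (auxEntry 0 1 (monodromy z t α γ) *ᵥ g)) := by
  have hw0 : w ≠ 0 := by rintro rfl; simp at hw; exact hz hw.symm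
  set A := auxEntry 0 0 (monodromy z t α γ)
  set B := auxEntry 0 1 (monodromy z t α γ)
  set A' := auxEntry 1 1 (monodromyTilde z t α γ)
  set B' := auxEntry 0 1 (monodromyTilde z t α γ)
  have hA := congrArg (fun f => B' *ᵥ f) (rowA_create α γ z t u g)
  have hB := congrArg (fun f => A' *ᵥ f) (rowB_create α γ z t u g)
  simp only [mulVec_smul, mulVec_sub] at hA hB
  have hB' := rowBTilde_create α γ z t u (A *ᵥ g)
  have hA' := rowATilde_create α γ z t u (B *ᵥ g)
  rw [doubleRowB_mulVec, doubleRowB_mulVec, create_add, create_smul, create_smul]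
  ext x
  have hA := congrFun hA x
  have hB := congrFun hB x
  have hA' := congrFun hA' x
  have hB' := congrFun hB' x
  simp only [Pi.add_apply, Pi.sub_apply, Pi.smul_apply, smul_eq_mul] at hA hB hA' hB' ⊢
  change _ * ((B' *ᵥ A *ᵥ create (wave α γ u) g) x) = _ * ((B' *ᵥ create (wave α γ u) (A *ᵥ g)) x)
    - _ * ((B' *ᵥ B *ᵥ g) x) at hA
  change _ * ((A' *ᵥ B *ᵥ create (wave α γ u) g) x) =
    _ * ((A' *ᵥ create (wave α γ u) (B *ᵥ g)) x) at hB
  change _ * ((B' *ᵥ create (wave α γ u) (A *ᵥ g)) x) =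
    _ * (create (wave α γ u) (B' *ᵥ A *ᵥ g) x) at hB'
  change _ * ((A' *ᵥ create (wave α γ u) (B *ᵥ g)) x) =
    _ * ((B' *ᵥ B *ᵥ g) x) - _ * (create (wave α γ u) (A' *ᵥ B *ᵥ g) x) at hA'
  change _ * (-s * w * ((B' *ᵥ A *ᵥ create (wave α γ u) g) x) +
    w⁻¹ * ((A' *ᵥ B *ᵥ create (wave α γ u) g) x)) = _ * (-s * w *
      create (wave α γ u) (B' *ᵥ A *ᵥ g) x + w⁻¹ * create (wave α γ u) (A' *ᵥ B *ᵥ g) x) -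
      _ * ((B' *ᵥ B *ᵥ g) x)
  generalize (B' *ᵥ A *ᵥ create (wave α γ u) g) x = X1 at *
  generalize (A' *ᵥ B *ᵥ create (wave α γ u) g) x = X2 at *
  generalize (B' *ᵥ create (wave α γ u) (A *ᵥ g)) x = X3 at *
  generalize (A' *ᵥ create (wave α γ u) (B *ᵥ g)) x = X4 at *
  generalize create (wave α γ u) (B' *ᵥ A *ᵥ g) x = X5 at *
  generalize create (wave α γ u) (A' *ᵥ B *ᵥ g) x = X6 at *
  generalize (B' *ᵥ B *ᵥ g) x = X7 at *
  have ht : t = -s ^ 2 := by rw [hs, neg_neg]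
  clear_value A B A' B'
  subst ht
  subst hw
  have e1 : (w ^ 2 * u - 1) * (w ^ 2 * u⁻¹ - 1) = w ^ 2 * u⁻¹ * ((u - (w ^ 2)⁻¹) * (w ^ 2 - u)) := by
    field_simp
  rw [e1]
  have e2 : (1 + -s ^ 2 * w ^ 2 * u) * (1 + -s ^ 2 * w ^ 2 * u⁻¹) =
      w ^ 2 * u⁻¹ * ((-s ^ 2 * u + (w ^ 2)⁻¹) * (-s ^ 2 * w ^ 2 + u)) := by
    field_simp
    ring
  rw [e2]
  -- The two unwanted contributions, one for each diagonal entry of the `K`-matrix, add up to a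
  -- product that separates `z` from `u`.
  have e3 : w⁻¹ * (1 - s * w ^ 2) * (1 + s * u) =
    -s * w * (w ^ 2 - u) * (w ^ 2)⁻¹ + w⁻¹ * (-s ^ 2 * u + (w ^ 2)⁻¹) * w ^ 2 := by
    field_simp
    ring
  linear_combination (w ^ 2 * u⁻¹) * ((-s * w) * (w ^ 2 - u) * hA + w⁻¹ * (w ^ 2 - u) * hB +
    (-s * w) * (-s ^ 2 * u + (w ^ 2)⁻¹) * hB' - w⁻¹ * (-s ^ 2 * u + (w ^ 2)⁻¹) * hA' +
    (-s ^ 2 + 1) * holeWeight γ u * X7 * e3)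

/-- The weights in `standingWave` turn both unwanted coefficients into the same multiple of `(u + s)
* (u⁻¹ + s)`, so their difference vanishes. -/
lemma doubleRowB_standingWave (hs : s ^ 2 = -t) (hw : w ^ 2 = z) (hz : z ≠ 0) (hu : u ≠ 0)
    (g : Config M → ℂ) :
    ((z * u - 1) * (z * u⁻¹ - 1)) •
        (doubleRowB t s z w α γ *ᵥ create (standingWave α γ s u) g) =
      ((1 + t * z * u) * (1 + t * z * u⁻¹)) •
          create (standingWave α γ s u) (doubleRowB t s z w α γ *ᵥ g) := by
  have h1 := doubleRowB_wave α γ hs hw hz hu g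
  have h2 := doubleRowB_wave α γ hs hw hz (inv_ne_zero hu) g
  rw [inv_inv] at h2
  simp only [standingWave, create_sub_left, create_smul_left, mulVec_sub, mulVec_smul]
  ext x
  have h1 := congrFun h1 x
  have h2 := congrFun h2 x
  simp only [Pi.sub_apply, Pi.smul_apply, smul_eq_mul] at h1 h2 ⊢
  have e : (u + s) * (u⁻¹ * (1 + s * u)) = (u⁻¹ + s) * (u * (1 + s * u⁻¹)) := by
    field_simp
  linear_combination (u + s) * holeWeight γ u⁻¹ * h1 - (u⁻¹ + s) * holeWeight γ u * h2 -
    holeWeight γ u * holeWeight γ u⁻¹ * (t + 1) * w⁻¹ * (1 - s * z) * z * ((auxEntry 0 1 (monodromyTilde z t α γ) *ᵥ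
            (auxEntry 0 1 (monodromy z t α γ) *ᵥ g)) x) * e

lemma doubleRowB_vacuum (hs : s ^ 2 = -t) (hw : w ^ 2 = z) (hz : z ≠ 0) :
    (z - z⁻¹) • (doubleRowB t s z w α γ *ᵥ vacuum M) =
      (w⁻¹ * (1 - s * z)) • create (standingWave α γ s z) (vacuum M) := by
  have hw0 : w ≠ 0 := by rintro rfl; simp at hw; exact hz hw.symm
  -- `B` creates the wave at `z⁻¹` from the vacuum, so `Ã` has to be moved past exactly that wave.
  have h := rowATilde_create α γ z t z⁻¹ (vacuum M)
  rw [rowATilde_vacuum, create_smul, rowBTilde_vacuum] at h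
  rw [doubleRowB_mulVec, rowA_vacuum, rowB_vacuum, mulVec_smul, rowBTilde_vacuum]
  simp only [standingWave, create_sub_left, create_smul_left]
  ext x
  have h := congrFun h x
  simp only [Pi.sub_apply, Pi.add_apply, Pi.smul_apply, smul_eq_mul] at h ⊢
  have ht : t = -s ^ 2 := by rw [hs, neg_neg]
  subst ht
  subst hw
  have e1 : -s * w * (w ^ 2 - (w ^ 2)⁻¹) + w⁻¹ * ((-s ^ 2 + 1) * w ^ 2) =
      w⁻¹ * (1 - s * w ^ 2) * (w ^ 2 + s) := by
    field_simp
    ring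
  have e2 : -s ^ 2 * w ^ 2 + (w ^ 2)⁻¹ = (1 - s * w ^ 2) * ((w ^ 2)⁻¹ + s) := by
    field_simp
    ring
  linear_combination w⁻¹ * h + holeWeight γ (w ^ 2)⁻¹ * create (wave α γ (w ^ 2)) (vacuum M) x * e1 -
    w⁻¹ * holeWeight γ (w ^ 2) * create (wave α γ (w ^ 2)⁻¹) (vacuum M) x * e2

end DoubleRow

/-! ### Slater determinants. -/

section Slater

variable {M : ℕ}

lemma particles_eq_one_iff {N : ℕ} (x : Fin N → Fin M) (k : Fin M) :
    particles x k = 1 ↔ ∃ j, x j = k := by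
  unfold particles
  split_ifs with h <;> simp [h]

lemma particles_eq_zero_iff {N : ℕ} (x : Fin N → Fin M) (k : Fin M) :
    particles x k = 0 ↔ ¬ ∃ j, x j = k := by
  unfold particles
  split_ifs with h <;> simp [h]

lemma jwSign_particles {N : ℕ} {x : Fin N → Fin M} (hx : StrictMono x) (i : Fin N) :
    jwSign (x i) (particles x) = (-1) ^ (i : ℕ) := by
  classical
  have h1 : jwSign (x i) (particles x) =
      ∏ k ∈ Finset.univ.filter (fun k : Fin M => k.val < (x i).val),
        if ∃ j, x j = k then (-1 : ℂ) else 1 := by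
    refine Finset.prod_congr rfl fun k _ => ?_
    unfold particles
    split_ifs with h <;> simp
  have h2 : ((Finset.univ.filter fun k : Fin M => k.val < (x i).val).filter
      fun k => ∃ j, x j = k) = (Finset.Iio i).image x := by
    ext k
    simp only [Finset.mem_filter, Finset.mem_univ, true_and, Finset.mem_image, Finset.mem_Iio]
    constructor
    · rintro ⟨hk, j, rfl⟩
      exact ⟨j, hx.lt_iff_lt.1 hk, rfl⟩
    · rintro ⟨j, hj, rfl⟩
      exact ⟨hx hj, j, rfl⟩
  rw [h1, Finset.prod_ite, Finset.prod_const, Finset.prod_const_one, mul_one, h2,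
    Finset.card_image_of_injective _ hx.injective, Fin.card_Iio]

lemma update_particles {n : ℕ} {x : Fin (n + 1) → Fin M} (hx : Injective x) (i : Fin (n + 1)) :
    update (particles x) (x i) 0 = particles (x ∘ i.succAbove) := by
  ext1 k
  by_cases hk : k = x i
  · subst hk
    rw [update_self, eq_comm, particles_eq_zero_iff]
    rintro ⟨j, hj⟩
    exact Fin.succAbove_ne i j (hx hj)
  · rw [update_of_ne hk]
    have : (∃ j, x j = k) ↔ ∃ j, (x ∘ i.succAbove) j = k := by
      constructor
      · rintro ⟨j, rfl⟩
        obtain ⟨l, rfl⟩ := Fin.exists_succAbove_eq (x := j) (y := i) (by rintro rfl; exact hk rfl)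
        exact ⟨l, rfl⟩
      · rintro ⟨j, rfl⟩
        exact ⟨_, rfl⟩
    simp only [particles, this]

lemma create_particles {n : ℕ} {x : Fin (n + 1) → Fin M} (hx : StrictMono x) (v : Fin M → ℂ)
    (f : Config M → ℂ) :
    create v f (particles x) =
      ∑ i : Fin (n + 1), (-1) ^ (i : ℕ) * v (x i) * f (particles (x ∘ i.succAbove)) := by
  classical
  have : (Finset.univ.filter fun j => ∃ i, x i = j) = Finset.univ.image x := by
    ext; simp
  simp only [create, particles_eq_one_iff]
  rw [← Finset.sum_filter, this, Finset.sum_image fun _ _ _ _ h => hx.injective h]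
  refine Finset.sum_congr rfl fun i _ => ?_
  rw [jwSign_particles hx, update_particles hx.injective]
  ring

/-- The outermost creation operator removes one particle at a time with its Jordan-Wigner sign,
which is the Laplace expansion along the first row. -/
lemma foldr_create_particles {N : ℕ} (v : Fin N → Fin M → ℂ) {x : Fin N → Fin M}
    (hx : StrictMono x) :
    (List.ofFn v).foldr create (vacuum M) (particles x) =
      Matrix.det (Matrix.of fun i j => v i (x j)) := by
  induction N with
  | zero =>
    have : particles x = 0 := by
      ext1 k
      rw [Pi.zero_apply, particles_eq_zero_iff]
      simp
    simp [this, vacuum]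
  | succ n ih =>
    rw [List.ofFn_succ, List.foldr_cons, create_particles hx, det_succ_row_zero]
    refine Finset.sum_congr rfl fun i _ => ?_
    rw [ih _ (hx.comp (Fin.strictMono_succAbove i))]
    rfl

lemma foldr_create_smul (l : List (Fin M → ℂ)) (c : ℂ) (f : Config M → ℂ) :
    l.foldr create (c • f) = c • l.foldr create f := by
  induction l with
  | nil => rfl
  | cons v l ih => rw [List.foldr_cons, ih, create_smul, List.foldr_cons]

end Slater

/-! ### The product of double row operators on the vacuum. -/

section Product

variable {M : ℕ} {t s : ℂ} (α γ : Fin M → ℂ)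

/-- The factor of the exchange of `𝓑(z)` with the standing wave of parameter `u`. -/
noncomputable def exchangeFactor (t z u : ℂ) : ℂ :=
  ((1 + t * z * u) * (1 + t * z * u⁻¹)) / ((z * u - 1) * (z * u⁻¹ - 1))

lemma doubleRowB_foldr (hs : s ^ 2 = -t) {z w : ℂ} (hw : w ^ 2 = z) (hz : z ≠ 0) (l : List ℂ)
    (hl : ∀ u ∈ l, u ≠ 0 ∧ (z * u - 1) * (z * u⁻¹ - 1) ≠ 0) (f : Config M → ℂ) :
    doubleRowB t s z w α γ *ᵥ (l.map (standingWave α γ s)).foldr create f =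
      (l.map (exchangeFactor t z)).prod •
        (l.map (standingWave α γ s)).foldr create (doubleRowB t s z w α γ *ᵥ f) := by
  induction l with
  | nil => simp
  | cons u l ih =>
    obtain ⟨hu, hd⟩ := hl u (by simp)
    simp only [List.map_cons, List.foldr_cons, List.prod_cons]
    have h := doubleRowB_standingWave α γ hs hw hz hu ((l.map (standingWave α γ s)).foldr create f)
    rw [ih fun u hu => hl u (by simp [hu]), create_smul, ← eq_inv_smul_iff₀ hd] at h
    rw [h, smul_smul, smul_smul, exchangeFactor]
    congr 1
    ring

lemma reverse_ofFn_eq {β : Type*} {n : ℕ} (f : Fin n → β) :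
    (List.ofFn f).reverse = List.ofFn fun i => f i.rev := by
  apply List.ext_getElem
  · simp
  · intro i h1 h2
    simp only [List.getElem_reverse, List.getElem_ofFn, List.length_ofFn]
    congr 1
    ext
    simp [Fin.val_rev]
    omega

/-- The leftmost operator is moved past all standing waves made by the others before it meets the
vacuum. Its own wave becomes the innermost one, which is why the list is reversed. -/
lemma doubleRowProd_vacuum (hs : s ^ 2 = -t) {N : ℕ} {z w : Fin N → ℂ}
    (hw : ∀ j, w j ^ 2 = z j) (hz : ∀ j, z j ≠ 0) (h1 : ∀ j, z j - (z j)⁻¹ ≠ 0)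
    (h2 : ∀ j k, j < k → (z j * z k - 1) * (z j * (z k)⁻¹ - 1) ≠ 0) :
    doubleRowProd t s z w α γ *ᵥ vacuum M =
      (∏ j, (w j)⁻¹ * (1 - s * z j) / (z j - (z j)⁻¹) *
        ∏ k ∈ Finset.Ioi j, exchangeFactor t (z j) (z k)) •
      (List.ofFn fun j => standingWave α γ s (z j)).reverse.foldr create (vacuum M) := by
  induction N with
  | zero => simp [doubleRowProd]
  | succ n ih =>
    have ih' := ih (z := fun j => z j.succ) (w := fun j => w j.succ) (fun j => hw _)
      (fun j => hz _) (fun j => h1 _) (fun j k h => h2 _ _ (Fin.succ_lt_succ_iff.2 h))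
    have e : doubleRowProd t s z w α γ = doubleRowB t s (z 0) (w 0) α γ *
        doubleRowProd t s (fun j => z j.succ) (fun j => w j.succ) α γ := by
      simp [doubleRowProd, List.ofFn_succ]
    have e2 : (List.ofFn fun j : Fin n => standingWave α γ s (z j.succ)).reverse =
        ((List.ofFn fun j : Fin n => z j.succ).reverse).map (standingWave α γ s) := by
      rw [List.map_reverse, List.map_ofFn]
      rfl
    have e3 := doubleRowB_vacuum α γ hs (hw 0) (hz 0) (M := M)
    rw [← eq_inv_smul_iff₀ (h1 0), smul_smul] at e3
    rw [e, ← mulVec_mulVec, ih', mulVec_smul, List.ofFn_succ, List.reverse_cons,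
      List.foldr_append, e2, doubleRowB_foldr α γ hs (hw 0) (hz 0), e3, foldr_create_smul,
      smul_smul, smul_smul, List.foldr_cons, List.foldr_nil]
    · congr 1
      rw [Fin.prod_univ_succ, Fin.prod_Ioi_zero, List.map_reverse, List.prod_reverse,
        List.map_ofFn, List.prod_ofFn]
      simp only [Fin.prod_Ioi_succ, Function.comp_apply]
      ring
    · intro u hu
      rw [List.mem_reverse, List.mem_ofFn] at hu
      obtain ⟨j, rfl⟩ := hu
      exact ⟨hz _, h2 _ _ (Fin.succ_pos j)⟩

end Product

/-! ### The Weyl denominator of type C. -/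

section WeylDenominator

open Polynomial

lemma chebyshevS_monic (m : ℕ) :
    (Chebyshev.S ℂ m).natDegree = m ∧ (Chebyshev.S ℂ m).Monic := by
  induction m using Nat.twoStepInduction with
  | zero => simp
  | one => simp [monic_X]
  | more m ih0 ih1 =>
    have e : Chebyshev.S ℂ ((m + 2 : ℕ) : ℤ) =
        X * Chebyshev.S ℂ ((m + 1 : ℕ) : ℤ) - Chebyshev.S ℂ (m : ℤ) := by
      push_cast
      exact Chebyshev.S_add_two ℂ m
    have hm : (X * Chebyshev.S ℂ ((m + 1 : ℕ) : ℤ)).Monic := monic_X.mul ih1.2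
    have hd : (X * Chebyshev.S ℂ ((m + 1 : ℕ) : ℤ)).natDegree = m + 2 := by
      rw [monic_X.natDegree_mul ih1.2, ih1.1, natDegree_X]
      ring
    have hlt : (Chebyshev.S ℂ (m : ℤ)).degree < (X * Chebyshev.S ℂ ((m + 1 : ℕ) : ℤ)).degree := by
      rw [degree_eq_natDegree ih0.2.ne_zero, degree_eq_natDegree hm.ne_zero, ih0.1, hd]
      exact_mod_cast (by omega : m < m + 2)
    rw [e]
    refine ⟨?_, hm.sub_of_left hlt⟩
    rw [natDegree_sub_eq_left_of_natDegree_lt, hd]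
    rw [ih0.1, hd]
    omega

lemma sub_inv_mul_chebyshevS (z : ℂ) (hz : z ≠ 0) (m : ℕ) :
    (z - z⁻¹) * (Chebyshev.S ℂ m).eval (z + z⁻¹) = z ^ (m + 1) - z⁻¹ ^ (m + 1) := by
  induction m using Nat.twoStepInduction with
  | zero => simp
  | one =>
    simp
    ring
  | more m ih0 ih1 =>
    have e : Chebyshev.S ℂ ((m + 2 : ℕ) : ℤ) =
        X * Chebyshev.S ℂ ((m + 1 : ℕ) : ℤ) - Chebyshev.S ℂ (m : ℤ) := by
      push_cast
      exact Chebyshev.S_add_two ℂ m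
    have h : z * z⁻¹ = 1 := mul_inv_cancel₀ hz
    rw [e, eval_sub, eval_mul, eval_X]
    linear_combination (z + z⁻¹) * ih1 - ih0 + (z ^ (m + 1) - z⁻¹ ^ (m + 1)) * h

lemma prod_Ioi_rev {N : ℕ} (f : Fin N → Fin N → ℂ) :
    ∏ i : Fin N, ∏ j ∈ Finset.Ioi i, f j.rev i.rev = ∏ i : Fin N, ∏ j ∈ Finset.Ioi i, f i j := by
  have h : ∀ g : Fin N → Fin N → ℂ, ∏ i : Fin N, ∏ j ∈ Finset.Ioi i, g i j =
      ∏ i, ∏ j, if i < j then g i j else 1 := by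
    intro g
    refine Finset.prod_congr rfl fun i _ => ?_
    rw [← Finset.prod_filter]
    refine Finset.prod_congr ?_ fun _ _ => rfl
    ext; simp
  rw [h, h fun i j => f i j, Finset.prod_comm, ← Equiv.prod_comp Fin.revPerm]
  refine Finset.prod_congr rfl fun i _ => ?_
  rw [← Equiv.prod_comp Fin.revPerm]
  refine Finset.prod_congr rfl fun j _ => ?_
  simp [Fin.revPerm_apply]

/-- Since `z ^ (m + 1) - z⁻¹ ^ (m + 1)` is `z - z⁻¹` times a monic polynomial of degree `m` in `z +
z⁻¹`, the rescaled Chebyshev polynomial `S`, the determinant reduces to a Vandermonde determinant.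
-/
lemma weylDenom_eq {N : ℕ} {z : Fin N → ℂ} (hz : ∀ j, z j ≠ 0) :
    weylDenom z = ∏ j, (z j - (z j)⁻¹) *
      ∏ k ∈ Finset.Ioi j, (z j + (z j)⁻¹ - (z k + (z k)⁻¹)) := by
  have e : weylDenom z = Matrix.det (Matrix.of fun j k : Fin N =>
      (z j.rev - (z j.rev)⁻¹) *
        (Matrix.of fun j k : Fin N => (Chebyshev.S ℂ (k : ℕ)).eval (z j.rev + (z j.rev)⁻¹)) j k) := by
    rw [weylDenom, ← det_submatrix_equiv_self Fin.revPerm, ← det_transpose]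
    congr 1
    ext j k
    have hk : (N : ℤ) - (k.rev : ℕ) = ((k.val + 1 : ℕ) : ℤ) := by
      rw [Fin.val_rev]
      omega
    simp only [transpose_apply, submatrix_apply, of_apply, Fin.revPerm_apply, hk]
    rw [sub_inv_mul_chebyshevS _ (hz _), _root_.zpow_neg, zpow_natCast, inv_pow]
  rw [e, det_mul_column, ← det_eval_matrixOfPolynomials_eq_det_vandermonde _ _
    (fun i => (chebyshevS_monic i).1) (fun i => (chebyshevS_monic i).2), det_vandermonde,
    Finset.prod_mul_distrib]
  congr 1
  · exact Equiv.prod_comp Fin.revPerm fun j => z j - (z j)⁻¹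
  · exact prod_Ioi_rev fun i j => z i + (z i)⁻¹ - (z j + (z j)⁻¹)

end WeylDenominator

/-! ### The wavefunction formula. -/

section Wavefunction

variable {M N : ℕ} {t s : ℂ} {z w : Fin N → ℂ}

lemma diagram_add_rev {lam : Fin N → ℕ} {x : Fin N → Fin M} (hlam : IsDiagramOf lam x)
    (j : Fin N) : lam j + (j.rev : ℕ) = (x j.rev : ℕ) := by
  have := hlam j
  have h := Fin.val_rev j
  have := j.isLt
  omega

/-- The reversed creation order and the decreasing order of the parts of `lam` reverse both rows and
columns, so no sign appears. -/
lemma hDet_eq_foldr_create (α γ : Fin M → ℂ) {x : Fin N → Fin M} (hx : StrictMono x)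
    {lam : Fin N → ℕ} (hlam : IsDiagramOf lam x) :
    (List.ofFn fun j => standingWave α γ s (z j)).reverse.foldr create (vacuum M) (particles x) =
      hDet s α γ lam z := by
  rw [reverse_ofFn_eq, foldr_create_particles _ hx, hDet, ← det_transpose,
    ← det_submatrix_equiv_self Fin.revPerm]
  congr 1
  ext j k
  simp [standingWave_apply, ← diagram_add_rev hlam]

lemma mul_sub_one_eq {a b : ℂ} (ha : a ≠ 0) (hb : b ≠ 0) :
    (a * b - 1) * (a * b⁻¹ - 1) = a * (a + a⁻¹ - (b + b⁻¹)) := by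
  field_simp
  ring

lemma zpow_sqrt {a b : ℂ} (h : b ^ 2 = a) (j : Fin N) :
    b ^ (2 * ((j : ℤ) + 1) - 1 - 2 * (N : ℤ)) = b⁻¹ * (a ^ (N - 1 - j.val))⁻¹ := by
  rw [← h, ← pow_mul, ← mul_inv, ← pow_succ', ← zpow_natCast, ← _root_.zpow_neg]
  congr 1
  have := j.isLt
  omega

/-- Each exchange denominator is `z j` times a Vandermonde factor. The `N - 1 - j` copies of `z j`,
together with `(w j)⁻¹` from the vacuum step, give the half-integral power in the prefactor. -/
lemma prefactorII_div_weylDenom (hw : ∀ j, w j ^ 2 = z j) (hz : ∀ j, z j ≠ 0) :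
    prefactorII t s z w / weylDenom z =
      ∏ j, (w j)⁻¹ * (1 - s * z j) / (z j - (z j)⁻¹) *
        ∏ k ∈ Finset.Ioi j, exchangeFactor t (z j) (z k) := by
  rw [weylDenom_eq hz, prefactorII, ← Finset.prod_mul_distrib, ← Finset.prod_div_distrib]
  refine Finset.prod_congr rfl fun j _ => ?_
  have e2 : ∏ k ∈ Finset.Ioi j, exchangeFactor t (z j) (z k) =
      (∏ k ∈ Finset.Ioi j, (1 + t * z j * z k) * (1 + t * z j * (z k)⁻¹)) /
        (z j ^ (N - 1 - j.val) *
          ∏ k ∈ Finset.Ioi j, (z j + (z j)⁻¹ - (z k + (z k)⁻¹))) := by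
    rw [← Fin.card_Ioi, ← Finset.prod_const, ← Finset.prod_mul_distrib, ← Finset.prod_div_distrib]
    refine Finset.prod_congr rfl fun k _ => ?_
    rw [exchangeFactor, mul_sub_one_eq (hz j) (hz k)]
  rw [zpow_sqrt (hw j), e2]
  simp only [div_eq_mul_inv, mul_inv]
  ring

theorem wavefunctionII_eq (hs : s ^ 2 = -t) (hw : ∀ j, w j ^ 2 = z j) (hz : ∀ j, z j ≠ 0)
    (α γ : Fin M → ℂ) {x : Fin N → Fin M} (hx : StrictMono x) {lam : Fin N → ℕ}
    (hlam : IsDiagramOf lam x) (hD : weylDenom z ≠ 0) :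
    wavefunctionII t s z w α γ x = prefactorII t s z w * oPlus s α γ lam z := by
  have hD' := hD
  rw [weylDenom_eq hz, Finset.prod_ne_zero_iff] at hD'
  have h1 : ∀ j, z j - (z j)⁻¹ ≠ 0 := fun j => left_ne_zero_of_mul (hD' j (Finset.mem_univ j))
  have h2 : ∀ j k, j < k → (z j * z k - 1) * (z j * (z k)⁻¹ - 1) ≠ 0 := by
    intro j k hjk
    have h := right_ne_zero_of_mul (hD' j (Finset.mem_univ j))
    rw [Finset.prod_ne_zero_iff] at h
    rw [mul_sub_one_eq (hz j) (hz k)]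
    exact mul_ne_zero (hz j) (h k (by simpa using hjk))
  have e : wavefunctionII t s z w α γ x =
      (doubleRowProd t s z w α γ *ᵥ vacuum M) (particles x) := by
    simp [wavefunctionII, mulVec, dotProduct, vacuum]
    rfl
  rw [e, doubleRowProd_vacuum α γ hs hw hz h1 h2, Pi.smul_apply, hDet_eq_foldr_create α γ hx hlam,
    ← prefactorII_div_weylDenom hw hz, oPlus, smul_eq_mul]
  ring

lemma oPlus_zero_zero {x : Fin N → Fin M} {lam : Fin N → ℕ} (hlam : IsDiagramOf lam x) :
    oPlus s (fun _ : Fin M => 0) (fun _ : Fin M => 0) lam z = bfhWhittaker s lam z := by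
  rw [oPlus, bfhWhittaker, hDet]
  congr 2
  ext j k
  have h : ∀ u : ℂ, hFun s (fun _ : Fin M => 0) (fun _ : Fin M => 0) (lam j + (j.rev : ℕ)) u =
      u ^ (lam j + (j.rev : ℕ)) * (u + s) := by
    intro u
    -- The index `μ` equals a position `x j.rev`, hence is below `M`, so the product over sites
    -- below `μ` really has `μ` factors.
    rw [diagram_add_rev hlam]
    have : (Finset.univ.filter fun i : Fin M => i.val < (x j.rev).val) = Finset.Iio (x j.rev) := by
      ext; simp
    simp only [hFun, this]
    simp [Fin.card_Iio, mul_comm]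
  simp only [of_apply, h]

end Wavefunction

/-! ### Particle-hole symmetry and particle conservation. -/

section ParticleHole

variable {M : ℕ}

/-- The exchange of particles and holes. -/
def flipConfig (M : ℕ) : Config M ≃ Config M := Equiv.piCongrRight fun _ => Fin.revPerm

/-- The exchange of particles and holes, also on the auxiliary space. -/
def flipAux (M : ℕ) : Fin 2 × Config M ≃ Fin 2 × Config M :=
  Equiv.prodCongr Fin.revPerm (flipConfig M)

lemma flipConfig_apply (s : Config M) (i : Fin M) : flipConfig M s i = (s i).rev := rfl

lemma flipConfig_flipConfig (s : Config M) : flipConfig M (flipConfig M s) = s := by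
  ext1 i
  simp [flipConfig_apply]

lemma flipAux_apply (a : Fin 2) (s : Config M) :
    flipAux M (a, s) = (a.rev, flipConfig M s) := rfl

/-- The number of particles. -/
def particleCount (s : Config M) : ℕ := ∑ i, (s i : ℕ)

lemma particleCount_add_flipConfig (s : Config M) :
    particleCount s + particleCount (flipConfig M s) = M := by
  rw [particleCount, particleCount, ← Finset.sum_add_distrib]
  have : ∀ i, (s i : ℕ) + (flipConfig M s i : ℕ) = 1 := fun i => by
    rw [flipConfig_apply, Fin.val_rev]
    omega
  simp [this]

lemma gammaL_eq_deltaL {t : ℂ} (ht : t ≠ 0) (y α γ : ℂ) (p q : Fin 2 × Fin 2) :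
    gammaL y t α γ q p =
      t ^ (p.2 : ℕ) * deltaL (y / t) t (-α) (-γ) (p.1.rev, p.2.rev) (q.1.rev, q.2.rev) := by
  obtain ⟨a, σ⟩ := p
  obtain ⟨b, τ⟩ := q
  rcases fin_two_cases a with rfl | rfl <;> rcases fin_two_cases b with rfl | rfl <;>
  rcases fin_two_cases σ with rfl | rfl <;> rcases fin_two_cases τ with rfl | rfl <;>
  simp [gammaL, deltaL, onPair, finProdFinEquiv, Fin.rev] <;> field_simp <;> ring

lemma atSite_gammaL {t : ℂ} (ht : t ≠ 0) (k : Fin M) (y α γ : ℂ) (p q : Fin 2 × Config M) :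
    atSite k (gammaL y t α γ) q p =
      t ^ (p.2 k : ℕ) *
        atSite k (deltaL (y / t) t (-α) (-γ)) (flipAux M p) (flipAux M q) := by
  obtain ⟨a, σ⟩ := p
  obtain ⟨b, τ⟩ := q
  simp only [atSite, flipAux_apply, flipConfig_apply, Fin.rev_inj]
  rw [gammaL_eq_deltaL ht]
  by_cases h : ∀ i, i ≠ k → τ i = σ i
  · rw [if_pos h, if_pos fun i hi => (h i hi).symm]
  · rw [if_neg h, if_neg fun h' => h fun i hi => (h' i hi).symm, mul_zero]

lemma atSite_ne_zero {k : Fin M} {A : Matrix (Fin 2 × Fin 2) (Fin 2 × Fin 2) ℂ}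
    {p q : Fin 2 × Config M} (h : atSite k A p q ≠ 0) :
    (∀ i, i ≠ k → p.2 i = q.2 i) ∧ A (p.1, p.2 k) (q.1, q.2 k) ≠ 0 := by
  unfold atSite at h
  split_ifs at h with h'
  · exact ⟨h', h⟩
  · exact absurd rfl h

/-- Each site occurs once, so its occupation is still that of `p` when its factor acts, and all
powers of `t` can be read from `p`. The transposes account for the opposite site orders of the two
monodromies. -/
lemma prod_atSite_gammaL {t : ℂ} (ht : t ≠ 0) (y : ℂ) (α γ : Fin M → ℂ) (l : List (Fin M))
    (hl : l.Nodup) (p q : Fin 2 × Config M) :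
    (l.map fun k => (atSite k (gammaL y t (α k) (γ k)))ᵀ).prod p q =
      (l.map fun k => t ^ (p.2 k : ℕ)).prod *
        (l.map fun k => atSite k (deltaL (y / t) t (-α k) (-γ k))).prod
          (flipAux M p) (flipAux M q) := by
  induction l generalizing p with
  | nil => simp [one_apply]
  | cons k l ih =>
    rw [List.nodup_cons] at hl
    simp only [List.map_cons, List.prod_cons, mul_apply]
    rw [Finset.mul_sum]
    refine Eq.trans ?_ (Equiv.sum_comp (flipAux M) _)
    refine Finset.sum_congr rfl fun r _ => ?_
    rw [transpose_apply, atSite_gammaL ht, ih hl.2]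
    by_cases h : atSite k (deltaL (y / t) t (-α k) (-γ k)) (flipAux M p) (flipAux M r) = 0
    · rw [h]; ring
    · have h' := (atSite_ne_zero h).1
      have e : (l.map fun j => t ^ (r.2 j : ℕ)) = l.map fun j => t ^ (p.2 j : ℕ) := by
        refine List.map_congr_left fun j hj => ?_
        have : (flipAux M p).2 j = (flipAux M r).2 j := h' j (by rintro rfl; exact hl.1 hj)
        rw [show p.2 j = r.2 j from Fin.rev_injective this]
      rw [e]
      ring

lemma monodromy_eq_monodromyTilde {t : ℂ} (ht : t ≠ 0) (z : ℂ) (α γ : Fin M → ℂ)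
    (p q : Fin 2 × Config M) :
    monodromy z t α γ q p = t ^ particleCount p.2 *
      monodromyTilde (z⁻¹ / t) t (fun i => -α i) (fun i => -γ i) (flipAux M p) (flipAux M q) := by
  rw [← transpose_apply (monodromy z t α γ), monodromy, transpose_list_prod, List.map_reverse,
    List.reverse_reverse, List.ofFn_eq_map, List.map_map, monodromyTilde, List.ofFn_eq_map]
  refine (prod_atSite_gammaL ht z⁻¹ α γ _ (List.nodup_finRange M) p q).trans ?_
  rw [← List.ofFn_eq_map, List.prod_ofFn, Finset.prod_pow_eq_pow_sum, particleCount]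

/-- The number of particles, the auxiliary space included. -/
def charge (p : Fin 2 × Config M) : ℕ := p.1 + particleCount p.2

lemma sixVertex_ne_zero {a₁ a₂ b₁ b₂ c₁ c₂ : ℂ} {p q : Fin 2 × Fin 2}
    (h : sixVertex a₁ a₂ b₁ b₂ c₁ c₂ p q ≠ 0) : (p.1 : ℕ) + p.2 = q.1 + q.2 := by
  obtain ⟨a, σ⟩ := p
  obtain ⟨b, τ⟩ := q
  rcases fin_two_cases a with rfl | rfl <;> rcases fin_two_cases b with rfl | rfl <;>
  rcases fin_two_cases σ with rfl | rfl <;> rcases fin_two_cases τ with rfl | rfl <;>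
  simp [sixVertex, onPair, finProdFinEquiv] at h ⊢

lemma atSite_sixVertex_charge {k : Fin M} {a₁ a₂ b₁ b₂ c₁ c₂ : ℂ} {p q : Fin 2 × Config M}
    (h : atSite k (sixVertex a₁ a₂ b₁ b₂ c₁ c₂) p q ≠ 0) : charge p = charge q := by
  obtain ⟨h1, h2⟩ := atSite_ne_zero h
  have h2 := sixVertex_ne_zero h2
  simp only at h2
  have h3 : ∑ i ∈ Finset.univ.erase k, (p.2 i : ℕ) = ∑ i ∈ Finset.univ.erase k, (q.2 i : ℕ) :=
    Finset.sum_congr rfl fun i hi => by rw [h1 i (Finset.ne_of_mem_erase hi)]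
  simp only [charge, particleCount, ← Finset.add_sum_erase _ _ (Finset.mem_univ k)]
  omega

lemma list_prod_charge {ι : Type*} [Fintype ι] [DecidableEq ι] (c : ι → ℕ)
    (l : List (Matrix ι ι ℂ)) (h : ∀ A ∈ l, ∀ p q, A p q ≠ 0 → c p = c q) (p q : ι)
    (hpq : l.prod p q ≠ 0) : c p = c q := by
  induction l generalizing p with
  | nil =>
    rw [List.prod_nil, one_apply] at hpq
    split_ifs at hpq with e
    · rw [e]
    · exact absurd rfl hpq
  | cons A l ih =>
    rw [List.prod_cons, mul_apply] at hpq
    obtain ⟨r, _, hr⟩ := Finset.exists_ne_zero_of_sum_ne_zero hpq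
    rw [h A (by simp) p r (left_ne_zero_of_mul hr)]
    exact ih (fun B hB => h B (by simp [hB])) r (right_ne_zero_of_mul hr)

lemma monodromy_charge {z t : ℂ} {α γ : Fin M → ℂ} {p q : Fin 2 × Config M}
    (h : monodromy z t α γ p q ≠ 0) : charge p = charge q := by
  refine list_prod_charge charge _ (fun A hA p q hpq => ?_) p q h
  rw [List.mem_reverse, List.mem_ofFn] at hA
  obtain ⟨k, rfl⟩ := hA
  exact atSite_sixVertex_charge hpq

lemma monodromyTilde_charge {z t : ℂ} {α γ : Fin M → ℂ} {p q : Fin 2 × Config M}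
    (h : monodromyTilde z t α γ p q ≠ 0) : charge p = charge q := by
  refine list_prod_charge charge _ (fun A hA p q hpq => ?_) p q h
  rw [List.mem_ofFn] at hA
  obtain ⟨k, rfl⟩ := hA
  exact atSite_sixVertex_charge hpq

/-- Both monodromies conserve the charge, and in each summand one factor turns an occupied auxiliary
line into an empty one. -/
lemma doubleRowB_particleCount {t s z w : ℂ} {α γ : Fin M → ℂ} {a b : Config M}
    (h : doubleRowB t s z w α γ a b ≠ 0) : particleCount a = particleCount b + 1 := by
  rw [doubleRowB, Matrix.add_apply, Matrix.smul_apply, Matrix.smul_apply, mul_apply, mul_apply] at h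
  by_contra hne
  apply h
  have e1 : ∀ r, auxEntry 0 1 (monodromyTilde z t α γ) a r *
      auxEntry 0 0 (monodromy z t α γ) r b = 0 := by
    intro r
    by_contra hr
    have h1 := monodromyTilde_charge (left_ne_zero_of_mul hr)
    have h2 := monodromy_charge (right_ne_zero_of_mul hr)
    simp only [charge, Fin.val_zero, Fin.val_one] at h1 h2
    omega
  have e2 : ∀ r, auxEntry 1 1 (monodromyTilde z t α γ) a r *
      auxEntry 0 1 (monodromy z t α γ) r b = 0 := by
    intro r
    by_contra hr
    have h1 := monodromyTilde_charge (left_ne_zero_of_mul hr)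
    have h2 := monodromy_charge (right_ne_zero_of_mul hr)
    simp only [charge, Fin.val_zero, Fin.val_one] at h1 h2
    omega
  simp [e1, e2]

/-- Transposition with spin flip exchanges the summands `B̃ A` and `Ã B`. The `K`-matrix is
compatible: at the new parameters its diagonal entries are swapped, up to the common factor `r / s`.
-/
lemma doubleRowB_flip {t s z w r : ℂ} (ht : t ≠ 0) (hs : s ^ 2 = -t) (hr : r ^ 2 = t)
    (hz : z ≠ 0) (hw : w ^ 2 = z) (α γ : Fin M → ℂ) (a b : Config M) :
    doubleRowB t s z w α γ a b =
      r / s * t ^ (2 * (particleCount b : ℤ) + 1 - M) *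
        doubleRowB t (-s) (t * z)⁻¹ (r * w)⁻¹ (fun i => -α i) (fun i => -γ i)
          (flipConfig M b) (flipConfig M a) := by
  have hs0 : s ≠ 0 := by rintro rfl; simp at hs; exact ht hs
  have hr0 : r ≠ 0 := by rintro rfl; simp at hr; exact ht hr.symm
  have hw0 : w ≠ 0 := by rintro rfl; simp at hw; exact hz hw.symm
  have hT : ∀ p q, monodromy z t α γ q p = t ^ particleCount p.2 *
      monodromyTilde (t * z)⁻¹ t (fun i => -α i) (fun i => -γ i) (flipAux M p) (flipAux M q) := by
    intro p q
    rw [monodromy_eq_monodromyTilde ht]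
    congr 3
    field_simp
  have hT' : ∀ p q : Fin 2 × Config M, monodromy (t * z)⁻¹ t (fun i => -α i) (fun i => -γ i) q p =
      t ^ particleCount p.2 * monodromyTilde z t α γ (flipAux M p) (flipAux M q) := by
    intro p q
    rw [monodromy_eq_monodromyTilde ht]
    have : (t * z)⁻¹⁻¹ / t = z := by field_simp
    simp only [this, neg_neg]
  have hrev0 : (0 : Fin 2).rev = 1 := rfl
  have hrev1 : (1 : Fin 2).rev = 0 := rfl
  have key : t ^ particleCount (flipConfig M a) * doubleRowB t s z w α γ a b =
      r / s * t ^ particleCount b *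
        doubleRowB t (-s) (t * z)⁻¹ (r * w)⁻¹ (fun i => -α i) (fun i => -γ i)
          (flipConfig M b) (flipConfig M a) := by
    have k1 : kMatrixII s w 0 0 = r / s * kMatrixII (-s) (r * w)⁻¹ 1 1 := by
      simp only [kMatrixII, of_apply, cons_val_zero, cons_val_one, inv_inv]
      field_simp
      rw [hr, hs]
      ring
    have k2 : kMatrixII s w 1 1 = r / s * kMatrixII (-s) (r * w)⁻¹ 0 0 := by
      simp only [kMatrixII, of_apply, cons_val_zero, cons_val_one]
      field_simp
    rw [doubleRowB, doubleRowB, Matrix.add_apply, Matrix.add_apply, Matrix.smul_apply, Matrix.smul_apply, Matrix.smul_apply,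
      Matrix.smul_apply, mul_apply, mul_apply, mul_apply, mul_apply, k1, k2]
    have e1 : t ^ particleCount (flipConfig M a) *
        ∑ c, auxEntry 0 1 (monodromyTilde z t α γ) a c * auxEntry 0 0 (monodromy z t α γ) c b =
        t ^ particleCount b * ∑ c, auxEntry 1 1 (monodromyTilde (t * z)⁻¹ t (fun i => -α i)
            (fun i => -γ i)) (flipConfig M b) c *
          auxEntry 0 1 (monodromy (t * z)⁻¹ t (fun i => -α i) (fun i => -γ i)) c
            (flipConfig M a) := by
      rw [← Equiv.sum_comp (flipConfig M) fun c => auxEntry 1 1 (monodromyTilde (t * z)⁻¹ t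
        (fun i => -α i) (fun i => -γ i)) (flipConfig M b) c * auxEntry 0 1 (monodromy (t * z)⁻¹ t
          (fun i => -α i) (fun i => -γ i)) c (flipConfig M a), Finset.mul_sum, Finset.mul_sum]
      refine Finset.sum_congr rfl fun c _ => ?_
      simp only [auxEntry, hT, hT', flipAux_apply, flipConfig_flipConfig, hrev0, hrev1]
      ring
    have e2 : t ^ particleCount (flipConfig M a) *
        ∑ c, auxEntry 1 1 (monodromyTilde z t α γ) a c * auxEntry 0 1 (monodromy z t α γ) c b =
        t ^ particleCount b * ∑ c, auxEntry 0 1 (monodromyTilde (t * z)⁻¹ t (fun i => -α i)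
            (fun i => -γ i)) (flipConfig M b) c *
          auxEntry 0 0 (monodromy (t * z)⁻¹ t (fun i => -α i) (fun i => -γ i)) c
            (flipConfig M a) := by
      rw [← Equiv.sum_comp (flipConfig M) fun c => auxEntry 0 1 (monodromyTilde (t * z)⁻¹ t
        (fun i => -α i) (fun i => -γ i)) (flipConfig M b) c * auxEntry 0 0 (monodromy (t * z)⁻¹ t
          (fun i => -α i) (fun i => -γ i)) c (flipConfig M a), Finset.mul_sum, Finset.mul_sum]
      refine Finset.sum_congr rfl fun c _ => ?_
      simp only [auxEntry, hT, hT', flipAux_apply, flipConfig_flipConfig, hrev0, hrev1]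
      ring
    simp only [smul_eq_mul]
    linear_combination r / s * kMatrixII (-s) (r * w)⁻¹ 1 1 * e1 +
      r / s * kMatrixII (-s) (r * w)⁻¹ 0 0 * e2
  -- The stated exponent depends on `b` alone through particle conservation, which holds only for
  -- nonzero entries; a zero entry forces the flipped one to vanish as well.
  by_cases h0 : doubleRowB t s z w α γ a b = 0
  · rw [h0, mul_zero, eq_comm, mul_eq_zero] at key
    rcases key with key | key
    · exact absurd key (mul_ne_zero (div_ne_zero hr0 hs0) (pow_ne_zero _ ht))
    · rw [h0, key, mul_zero]
  · have hc := doubleRowB_particleCount h0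
    have hM := particleCount_add_flipConfig a
    have e : (2 * (particleCount b : ℤ) + 1 - M) =
        (particleCount b : ℤ) - (particleCount (flipConfig M a) : ℤ) := by omega
    rw [e, zpow_sub₀ ht, zpow_natCast, zpow_natCast]
    have := pow_ne_zero (particleCount (flipConfig M a)) ht
    field_simp
    field_simp at key
    linear_combination key

/-- The exponent is the sum of `2 * (c + i) + 1 - M` over `i < N`, where `c` counts the particles of
`b`: each factor raises the count by one. Conservation and the flip identity are proved together
because the second uses the first. -/
lemma prod_flip {t ρ : ℂ} (ht : t ≠ 0) {N : ℕ} (X Y : Fin N → QOp M)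
    (hc : ∀ j a b, X j a b ≠ 0 → particleCount a = particleCount b + 1)
    (h : ∀ j a b, X j a b = ρ * t ^ (2 * (particleCount b : ℤ) + 1 - M) *
      Y j (flipConfig M b) (flipConfig M a)) (a b : Config M) :
    ((List.ofFn X).prod a b ≠ 0 → particleCount a = particleCount b + N) ∧
    (List.ofFn X).prod a b = ρ ^ N * t ^ ((N : ℤ) * (2 * (particleCount b : ℤ) + N - M)) *
      (List.ofFn Y).reverse.prod (flipConfig M b) (flipConfig M a) := by
  induction N generalizing a with
  | zero =>
    constructor
    · intro h
      simp only [List.ofFn_zero, List.prod_nil, one_apply] at h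
      split_ifs at h with e
      · simp [e]
      · exact absurd rfl h
    · simp [one_apply, eq_comm]
  | succ n ih =>
    have ih := ih (fun j => X j.succ) (fun j => Y j.succ) (fun j => hc _) (fun j => h _)
    constructor
    · intro hne
      rw [List.ofFn_succ, List.prod_cons, mul_apply] at hne
      obtain ⟨r, _, hr⟩ := Finset.exists_ne_zero_of_sum_ne_zero hne
      have h1 := hc _ _ _ (left_ne_zero_of_mul hr)
      have h2 := (ih r).1 (right_ne_zero_of_mul hr)
      omega
    · rw [List.ofFn_succ, List.ofFn_succ, List.prod_cons, List.reverse_cons, List.prod_append,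
        List.prod_singleton, mul_apply, mul_apply, Finset.mul_sum,
        ← Equiv.sum_comp (flipConfig M) fun c => _ * (_ * Y 0 c _)]
      refine Finset.sum_congr rfl fun c _ => ?_
      by_cases h0 : (List.ofFn fun j : Fin n => X j.succ).prod c b = 0
      · have h1 := (ih c).2
        rw [h0] at h1
        have h1 := h1.symm
        rw [h0, mul_zero]
        by_cases hρ : ρ = 0
        · simp [hρ]
        · have : (List.ofFn fun j : Fin n => Y j.succ).reverse.prod
              (flipConfig M b) (flipConfig M c) = 0 := by
            refine (mul_eq_zero.1 h1).resolve_left ?_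
            exact mul_ne_zero (pow_ne_zero _ hρ) (zpow_ne_zero _ ht)
          rw [this]
          ring
      · have h1 := (ih c).1 h0
        rw [h, (ih c).2, h1]
        have e : (((n + 1 : ℕ) : ℤ) * (2 * (particleCount b : ℤ) + (n + 1 : ℕ) - M)) =
            (2 * ((particleCount b + n : ℕ) : ℤ) + 1 - M) +
              (n : ℤ) * (2 * (particleCount b : ℤ) + n - M) := by
          push_cast
          ring
        rw [e, zpow_add₀ ht]
        ring

end ParticleHole

/-! ### The dual wavefunction. -/

section Dual

variable {M N : ℕ}

lemma flipConfig_holes (x : Fin N → Fin M) : flipConfig M (holes x) = particles x := by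
  ext1 k
  rw [flipConfig_apply]
  unfold holes particles
  split_ifs <;> rfl

lemma particleCount_particles {x : Fin N → Fin M} (hx : Injective x) :
    particleCount (particles x) = N := by
  classical
  have h : ∀ i, ((particles x i : Fin 2) : ℕ) = if ∃ j, x j = i then 1 else 0 := fun i => by
    unfold particles
    split_ifs <;> rfl
  have h2 : (Finset.univ.filter fun i => ∃ j, x j = i) = Finset.univ.image x := by
    ext; simp
  simp only [particleCount, h]
  rw [Finset.sum_boole, h2, Finset.card_image_of_injective _ hx]
  simp

lemma det_inv_rev {F : Fin N → ℂ → ℂ} (hF : ∀ j u, F j u⁻¹ = -F j u) (ζ : Fin N → ℂ) :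
    Matrix.det (Matrix.of fun j k : Fin N => F j (ζ k.rev)⁻¹) =
      (-1) ^ N * ((Equiv.Perm.sign (Fin.revPerm (n := N)) : ℤ) : ℂ) *
        Matrix.det (Matrix.of fun j k => F j (ζ k)) := by
  have e : (Matrix.of fun j k : Fin N => F j (ζ k.rev)⁻¹) =
      -((Matrix.of fun j k => F j (ζ k)).submatrix id (Fin.revPerm (n := N))) := by
    ext j k
    simp [hF]
  rw [e, det_neg, det_permute', Fintype.card_fin, mul_assoc]

/-- Numerator and denominator have entries odd under `u ↦ u⁻¹`, so inversion and column reversal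
multiply both by the same sign. -/
lemma hDet_div_weylDenom_inv_rev (c : ℂ) (α γ : Fin M → ℂ) (lam : Fin N → ℕ) (ζ : Fin N → ℂ) :
    hDet c α γ lam (fun j => (ζ j.rev)⁻¹) / weylDenom (fun j => (ζ j.rev)⁻¹) =
      hDet c α γ lam ζ / weylDenom ζ := by
  have h1 := det_inv_rev (F := fun j u => hFun c α γ (lam j + (j.rev : ℕ)) u -
    hFun c α γ (lam j + (j.rev : ℕ)) u⁻¹) (fun j u => by simp) ζ
  have h2 := det_inv_rev (F := fun (j : Fin N) (u : ℂ) => u ^ ((N : ℤ) - (j : ℤ)) -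
    u ^ (-((N : ℤ) - (j : ℤ)))) (fun j u => by simp [_root_.inv_zpow']) ζ
  rw [hDet, weylDenom, h1, h2, mul_div_mul_left, hDet, weylDenom]
  simp

lemma weylDenom_inv_rev_ne_zero {ζ : Fin N → ℂ} (h : weylDenom ζ ≠ 0) :
    weylDenom (fun j => (ζ j.rev)⁻¹) ≠ 0 := by
  have h2 := det_inv_rev (F := fun (j : Fin N) (u : ℂ) => u ^ ((N : ℤ) - (j : ℤ)) -
    u ^ (-((N : ℤ) - (j : ℤ)))) (fun j u => by simp [_root_.inv_zpow']) ζ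
  rw [weylDenom, h2]
  exact mul_ne_zero (by simp) h

lemma prod_Ioi_snd (g : Fin N → ℂ) :
    ∏ i : Fin N, ∏ j ∈ Finset.Ioi i, g j = ∏ j : Fin N, g j ^ (j : ℕ) := by
  rw [← prod_Ioi_rev fun _ j => g j, ← Equiv.prod_comp Fin.revPerm fun j => g j ^ (j : ℕ)]
  refine Finset.prod_congr rfl fun i _ => ?_
  rw [Finset.prod_const, Fin.card_Ioi, Fin.revPerm_apply, Fin.val_rev]
  congr 1
  omega

/-- Under inversion and reversal each pair factor reproduces the original one up to `(z i)⁻¹ * (t *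
z j)⁻¹`; these monomials are absorbed by the half-integral powers, and `r / s` by the linear
factors. -/
lemma prefactorII_flip {t s r : ℂ} (ht : t ≠ 0) (hs : s ^ 2 = -t) (hr : r ^ 2 = t)
    {z w : Fin N → ℂ} (hz : ∀ j, z j ≠ 0) (hw : ∀ j, w j ^ 2 = z j) :
    (r / s) ^ N * prefactorII t (-s) (fun j => (t * z j.rev)⁻¹) (fun j => (r * w j.rev)⁻¹) =
      prefactorII t s z w := by
  have hs0 : s ≠ 0 := by rintro rfl; simp at hs; exact ht hs
  have hr0 : r ≠ 0 := by rintro rfl; simp at hr; exact ht hr.symm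
  have e1 : ∏ j : Fin N, (r * w j.rev)⁻¹ ^ (2 * ((j : ℤ) + 1) - 1 - 2 * (N : ℤ)) *
      (1 - -s * (t * z j.rev)⁻¹) =
      ∏ j : Fin N, (r * w j * (t * z j) ^ (j : ℕ)) * (1 + s * (t * z j)⁻¹) := by
    rw [← Equiv.prod_comp Fin.revPerm fun j : Fin N =>
      (r * w j * (t * z j) ^ (j : ℕ)) * (1 + s * (t * z j)⁻¹)]
    refine Finset.prod_congr rfl fun j _ => ?_
    rw [zpow_sqrt (a := (t * z j.rev)⁻¹) (by rw [inv_pow, mul_pow, hr, hw]), Fin.revPerm_apply,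
      inv_inv, inv_pow, inv_inv]
    have : N - 1 - (j : ℕ) = (j.rev : ℕ) := by rw [Fin.val_rev]; omega
    rw [this]
    ring
  have e2 : ∏ i : Fin N, ∏ j ∈ Finset.Ioi i, (1 + t * (t * z i.rev)⁻¹ * (t * z j.rev)⁻¹) *
      (1 + t * (t * z i.rev)⁻¹ * (t * z j.rev)⁻¹⁻¹) =
      (∏ i : Fin N, ((z i) ^ (N - 1 - (i : ℕ)))⁻¹) * (∏ j : Fin N, ((t * z j) ^ (j : ℕ))⁻¹) *
        ∏ i : Fin N, ∏ j ∈ Finset.Ioi i, (1 + t * z i * z j) * (1 + t * z i * (z j)⁻¹) := by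
    rw [prod_Ioi_rev fun a b => (1 + t * (t * z b)⁻¹ * (t * z a)⁻¹) *
      (1 + t * (t * z b)⁻¹ * (t * z a)⁻¹⁻¹)]
    simp only [← inv_pow]
    rw [← prod_Ioi_snd fun j => (t * z j)⁻¹]
    have : ∀ i : Fin N, (z i)⁻¹ ^ (N - 1 - (i : ℕ)) = ∏ j ∈ Finset.Ioi i, (z i)⁻¹ := fun i => by
      rw [Finset.prod_const, Fin.card_Ioi]
    simp only [this, ← Finset.prod_mul_distrib]
    refine Finset.prod_congr rfl fun i _ => Finset.prod_congr rfl fun j _ => ?_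
    have := hz i
    have := hz j
    field_simp
    ring
  rw [prefactorII, e1, e2, prefactorII, ← mul_assoc, ← mul_assoc, ← mul_assoc]
  congr 1
  have e3 : (r / s) ^ N = ∏ j : Fin N, (r / s) := by
    rw [Finset.prod_const, Finset.card_univ, Fintype.card_fin]
  rw [e3, ← Finset.prod_mul_distrib, ← Finset.prod_mul_distrib, ← Finset.prod_mul_distrib]
  refine Finset.prod_congr rfl fun j _ => ?_
  have hw0 : w j ≠ 0 := fun h => hz j (by rw [← hw, h]; simp)
  have := hz j
  rw [zpow_sqrt (hw j)]
  have h4 : r / s * (r * w j) * (1 + s * (t * z j)⁻¹) = (w j)⁻¹ * (1 - s * z j) := by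
    have ht' : t = -s ^ 2 := by rw [hs, neg_neg]
    have : r / s * (r * w j) = -s * w j := by
      field_simp
      rw [hr, hs]
      ring
    rw [this, ht', ← hw]
    field_simp
    ring
  have h5 : (t * z j) ^ (j : ℕ) * ((t * z j) ^ (j : ℕ))⁻¹ = 1 :=
    mul_inv_cancel₀ (pow_ne_zero _ (mul_ne_zero ht (hz j)))
  linear_combination (z j ^ (N - 1 - (j : ℕ)))⁻¹ * h4 +
    r / s * (r * w j) * (1 + s * (t * z j)⁻¹) * (z j ^ (N - 1 - (j : ℕ)))⁻¹ * h5

theorem dualWavefunctionII_eq {t s : ℂ} (ht : t ≠ 0) (hs : s ^ 2 = -t) {z w : Fin N → ℂ}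
    (hw : ∀ j, w j ^ 2 = z j) (hz : ∀ j, z j ≠ 0) (α γ : Fin M → ℂ) {x : Fin N → Fin M}
    (hx : StrictMono x) {lam : Fin N → ℕ} (hlam : IsDiagramOf lam x)
    (hD : weylDenom (fun j => t * z j) ≠ 0) :
    dualWavefunctionII t s z w α γ x = t ^ (N * (M - N)) * prefactorII t s z w *
      oMinus s (fun i => -α i) (fun i => -γ i) lam (fun j => t * z j) := by
  -- An auxiliary square root of `t` makes `(r * w j)⁻¹` a square root of `(t * z j)⁻¹`; it drops
  -- out in `prefactorII_flip`.
  obtain ⟨r, hr⟩ : ∃ r : ℂ, r ^ 2 = t := IsAlgClosed.exists_pow_nat_eq t two_pos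
  have hflip := (prod_flip ht (ρ := r / s) (fun j : Fin N => doubleRowB t s (z j) (w j) α γ)
    (fun j : Fin N => doubleRowB t (-s) (t * z j)⁻¹ (r * w j)⁻¹ (fun i => -α i) (fun i => -γ i))
    (fun j a b => doubleRowB_particleCount)
    (fun j => doubleRowB_flip ht hs hr (hz j) (hw j) α γ) (fun _ => 1) (holes x)).2
  have hcount := particleCount_add_flipConfig (holes x)
  rw [flipConfig_holes, particleCount_particles hx.injective] at hcount
  have hexp : (N : ℤ) * (2 * (particleCount (holes x) : ℤ) + N - M) = ((N * (M - N) : ℕ) : ℤ) := by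
    have : particleCount (holes x) = M - N := by omega
    rw [this]
    push_cast
    rw [Nat.cast_sub (by omega)]
    ring
  have hvac : flipConfig M (fun _ => 1) = fun _ => 0 := by
    ext1 i
    rfl
  -- Transposition reversed the order of the double row operators, hence the reversed indices. Using
  -- `-s` as square root of `-t` turns `o⁺` into `o⁻`.
  have hwave := wavefunctionII_eq (s := -s) (t := t) (z := fun j => (t * z j.rev)⁻¹)
    (w := fun j => (r * w j.rev)⁻¹) (by rw [neg_sq, hs])
    (fun j => by rw [inv_pow, mul_pow, hr, hw]) (fun j => inv_ne_zero (mul_ne_zero ht (hz _)))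
    (fun i => -α i) (fun i => -γ i) hx hlam (weylDenom_inv_rev_ne_zero (ζ := fun j => t * z j) hD)
  rw [oPlus, hDet_div_weylDenom_inv_rev (-s) _ _ lam fun j => t * z j] at hwave
  rw [reverse_ofFn_eq, flipConfig_holes, hvac, hexp, zpow_natCast] at hflip
  rw [dualWavefunctionII, doubleRowProd, hflip, ← prefactorII_flip ht hs hr hz hw, oMinus]
  rw [wavefunctionII, doubleRowProd] at hwave
  rw [hwave]
  ring

end Dual

end ReflectingIce

theorem mainTheorem2 {M N : ℕ} (t s : ℂ) (hs : s ^ 2 = -t)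
    (z w : Fin N → ℂ) (hw : ∀ j, w j ^ 2 = z j) (hz : ∀ j, z j ≠ 0)
    (α γ : Fin M → ℂ) (x : Fin N → Fin M) (hx : StrictMono x)
    (lam : Fin N → ℕ) (hlam : ReflectingIce.IsDiagramOf lam x) :
    (ReflectingIce.weylDenom z ≠ 0 →
      ReflectingIce.wavefunctionII t s z w α γ x =
        ReflectingIce.prefactorII t s z w * ReflectingIce.oPlus s α γ lam z) ∧
    (t ≠ 0 → ReflectingIce.weylDenom (fun j => t * z j) ≠ 0 →
      ReflectingIce.dualWavefunctionII t s z w α γ x =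
        t ^ (N * (M - N)) * ReflectingIce.prefactorII t s z w *
          ReflectingIce.oMinus s (fun i => -α i) (fun i => -γ i) lam (fun j => t * z j)) ∧
    (ReflectingIce.weylDenom z ≠ 0 →
      ReflectingIce.wavefunctionII t s z w (fun _ : Fin M => 0) (fun _ : Fin M => 0) x =
        ReflectingIce.prefactorII t s z w * ReflectingIce.bfhWhittaker s lam z) := by
  refine ⟨fun hD => ?_, fun ht hD => ?_, fun hD => ?_⟩
  · exact ReflectingIce.wavefunctionII_eq hs hw hz α γ hx hlam hD
  · exact ReflectingIce.dualWavefunctionII_eq ht hs hw hz α γ hx hlam hD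
  · rw [← ReflectingIce.oPlus_zero_zero hlam]
    exact ReflectingIce.wavefunctionII_eq hs hw hz _ _ hx hlam hD
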